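/- Consider $n\ge 2$ parties in a synchronous fully connected network with private channels, a prime $p\le n^{O(1)}$, messages $x_1,\dots,x_n\in\mathbb Z_p$, and quorums of $N=O(\log n)$ parties. Costs are worst-case costs of the programs of the parties (over their coins and over everything that corrupted parties may send), a field element has $\lceil\log_2 p\rceil$ bits, operations are field operations, tests and coin tosses, and $\tilde O(n)$ means $O(n\log^k n)$ for some constant $k$. The protocol $\mathsf{AnonymousBroadcast}$ uses the following given building blocks: * a quorum building protocol with $O(1)$ rounds that sends $\tilde O(n)$ bits and computes $\tilde O(n)$ operations in total, and returns $n$ quorums $Q_1,\dots,Q_n$ of $N$ parties each; * a secure broadcast protocol with $O(1)$ rounds, whose communication and computation are polynomial in the number of its participants and the length of the message; * a linear verifiable secret sharing (VSS) scheme with the cost profile of the perfectly secure scheme of Katz et al.: three rounds, one of which is a broadcast (carried out by the broadcast protocol), with communication and computation polynomial in the number $N$ of share holders; * a comparison protocol $\mathsf{Compare}$ on shared values with $O(1)$ rounds of $O(\log p)$ invocations of multiplication (generation of a random shared value, opening of a shared value) and $\mathrm{polylog}(p)$ local operations; * a comparator network on $n$ wires of depth $O(\log n)$, whose $i$-th gate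 is assigned to the quorum $Q_{i\bmod n}$. The other subprotocols are the following. $\mathsf{GenRand}$: every member of the quorum shares a random value by VSS, and the shares are added. $\mathsf{RenewShares}$: a random polynomial of degree $N/3$ vanishing at $0$, generated through VSS by all members, is added to the sharing. $\mathsf{Reconst}$: members exchange their shares, interpolate, and correct errors with the Berlekamp–Welch algorithm. $\mathsf{Multiply}(\langle a\rangle,\langle b\rangle)$: $\langle u\rangle,\langle v\rangle$ are generated by $\mathsf{GenRand}$ with degree $N/6$, $w_i=u_iv_i$, the three sharings are renewed, $\varepsilon=a+u$ and $\delta=b+v$ are reconstructed, and the result is $w_i+\delta a_i+\varepsilon b_i-\varepsilon\delta$. The protocol runs: (1) *Setup*: quorum building. (2) *Input sharing*: each party shares its message by VSS in the quorum of the first gate on its wire. (3) *Random generation*: this quorum runs $\mathsf{GenRand}$ to attach a random key to the message. (4) *Circuit computation*, level by level: the quorum of a gate with input pairs $(r,x),(r',x')$ computes $\rho=(r\le r')$ by $\mathsf{Compare}$ and then, with $\mathsf{Multiply}$, $s=\rho r+(1-\rho)r'$, $y=\rho x+(1-\rho)x'$, $s'=\rho r'+(1-\rho)r$, $y'=\rho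 x'+(1-\rho)x$, renews these sharings, and forwards them member by member to the quorum of the next gate. (5) *Output propagation*: the quorum of the last gate on each wire reconstructs the message and sends it to all $n$ parties, who take majorities. Then, in every run in which the parties agree on the quorums in step (1): 1. steps (1)–(4), the shuffling of the $n$ messages, send $\tilde O(n)$ bits in total; 2. steps (1)–(4) compute $\tilde O(n)$ operations in total; 3. the whole protocol, steps (1)–(5), takes $O(\log n)$ rounds of communication; 4. step (5), which is not included in the counts 1 and 2, sends $O(n^2\log n)$ field elements. All implied constants and exponents depend only on those in the assumptions. -/

import Mathlib

/-!
Synchronous point-to-point protocols over the field `ZMod p`, their worst-case costs, and the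
anonymous broadcast protocol with all its subprotocols, written as programs of the single parties.
-/

namespace AnonBroadcast

/-! ### Programs of a party and their costs -/

/-- A message: a list of field elements, or the messages of two sessions that run in parallel. -/
inductive Msg (p : ℕ) : Type
  | empty : Msg p
  | elems (l : List (ZMod p)) : Msg p
  | pair (a b : Msg p) : Msg p

namespace Msg
variable {p : ℕ}

/-- Number of field elements in a message (the schedule of the sessions is public, so that the
pairing carries no information). -/
def size : Msg p → ℕ
  | empty => 0
  | elems l => l.length
  | pair a b => a.size + b.size

def left : Msg p → Msg p
  | pair a _ => a
  | _ => empty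

def right : Msg p → Msg p
  | pair _ b => b
  | _ => empty

def list : Msg p → List (ZMod p)
  | elems l => l
  | _ => []

end Msg

/-- The operations that are counted as one step of local computation. -/
inductive FieldOp : Type
  | add | sub | mul | inv | eq | le

/-- Result of an operation; tests return `1` or `0`, `inv` ignores its second argument, and `le`
compares the representatives in `{0, …, p - 1}`. -/
def FieldOp.eval {p : ℕ} : FieldOp → ZMod p → ZMod p → ZMod p
  | add, x, y => x + y
  | sub, x, y => x - y
  | mul, x, y => x * y
  | inv, x, _ => x⁻¹
  | eq, x, y => if x = y then 1 else 0
  | le, x, y => if x.val ≤ y.val then 1 else 0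

/-- The program of one party in a synchronous network of the parties `Fin n` with private
channels. `comm out k` is one round: the message `out j` goes to party `j`, and the program
continues with `k` applied to the messages received (`inbox j` is the message from party `j`;
a corrupted party may have sent anything). `coin` draws a uniform field element. -/
inductive Party (n p : ℕ) (α : Type) : Type
  | done (a : α) : Party n p α
  | op (o : FieldOp) (x y : ZMod p) (k : ZMod p → Party n p α) : Party n p α
  | coin (k : ZMod p → Party n p α) : Party n p α
  | comm (out : Fin n → Msg p) (k : (Fin n → Msg p) → Party n p α) : Party n p α

namespace Party
variable {n p : ℕ} {α β σ : Type}

def bind : Party n p α → (α → Party n p β) → Party n p β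
  | done a, f => f a
  | op o x y k, f => op o x y (fun z => (k z).bind f)
  | coin k, f => coin (fun z => (k z).bind f)
  | comm out k, f => comm out (fun inbox => (k inbox).bind f)

instance : Monad (Party n p) where
  pure := done
  bind := bind

/-- Field elements sent, in the worst case over all coins and all messages received. -/
noncomputable def sent : Party n p α → ℕ∞
  | done _ => 0
  | op o x y k => (k (o.eval x y)).sent
  | coin k => ⨆ z, (k z).sent
  | comm out k => ((∑ j, (out j).size : ℕ) : ℕ∞) + ⨆ inbox, (k inbox).sent

/-- Bits sent, in the worst case; a field element has `⌈log₂ p⌉` bits. -/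
noncomputable def bits (P : Party n p α) : ℕ∞ := (Nat.clog 2 p : ℕ∞) * P.sent

/-- Operations computed, in the worst case. -/
noncomputable def ops : Party n p α → ℕ∞
  | done _ => 0
  | op o x y k => 1 + (k (o.eval x y)).ops
  | coin k => 1 + ⨆ z, (k z).ops
  | comm _ k => ⨆ inbox, (k inbox).ops

/-- Rounds of communication, in the worst case. -/
noncomputable def rounds : Party n p α → ℕ∞
  | done _ => 0
  | op o x y k => (k (o.eval x y)).rounds
  | coin k => ⨆ z, (k z).rounds
  | comm _ k => 1 + ⨆ inbox, (k inbox).rounds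

/-- Auxiliary to `par`: the first session waits with the messages `out`. -/
def parComm (out : Fin n → Msg p) (k : (Fin n → Msg p) → Party n p β → Party n p (α × β)) :
    Party n p β → Party n p (α × β)
  | done b => comm (fun j => .pair (out j) .empty) (fun inbox => k (fun j => (inbox j).left) (done b))
  | op o x y k' => op o x y (fun z => parComm out k (k' z))
  | coin k' => coin (fun z => parComm out k (k' z))
  | comm out' k' => comm (fun j => .pair (out j) (out' j))
      (fun inbox => k (fun j => (inbox j).left) (k' (fun j => (inbox j).right)))

/-- Auxiliary to `par`: the first session is over. -/
def parDone (a : α) : Party n p β → Party n p (α × β)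
  | done b => done (a, b)
  | op o x y k => op o x y (fun z => parDone a (k z))
  | coin k => coin (fun z => parDone a (k z))
  | comm out k => comm (fun j => .pair .empty (out j))
      (fun inbox => parDone a (k (fun j => (inbox j).right)))

/-- Two sessions in parallel: they share the rounds. -/
def par : Party n p α → Party n p β → Party n p (α × β)
  | done a => parDone a
  | op o x y k => fun q => op o x y (fun z => par (k z) q)
  | coin k => fun q => coin (fun z => par (k z) q)
  | comm out k => parComm out (fun inbox => par (k inbox))

/-- Finitely many sessions in parallel. -/
def parAll : (m : ℕ) → (Fin m → Party n p α) → Party n p (Fin m → α)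
  | 0, _ => done (fun i => i.elim0)
  | m + 1, f => do
      let r ← par (f 0) (parAll m (fun i => f i.succ))
      return Fin.cons r.1 r.2

/-- `R` idle rounds. -/
def idle (a : α) : ℕ → Party n p α
  | 0 => done a
  | R + 1 => comm (fun _ => .empty) (fun _ => idle a R)

/-- Idle rounds appended until `R` rounds have passed. -/
def pad : Party n p α → ℕ → Party n p α
  | done a, R => idle a R
  | op o x y k, R => op o x y (fun z => pad (k z) R)
  | coin k, R => coin (fun z => pad (k z) R)
  | comm out k, R => comm out (fun inbox => pad (k inbox) (R - 1))

/-- A step of a protocol in which all parties wait for the slowest one, so that they enter the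
next step in the same round. -/
noncomputable def lockstep (step : Fin n → σ → Party n p α) (me : Fin n) (s : σ) : Party n p α :=
  pad (step me s) (⨆ i, ⨆ s', (step i s').rounds).toNat

/-- One round: send the given field elements to each party, return what was received. -/
def exchange (out : Fin n → List (ZMod p)) : Party n p (Fin n → List (ZMod p)) :=
  comm (fun j => .elems (out j)) (fun inbox => done (fun j => (inbox j).list))

/-! ### Local computation -/

def add (x y : ZMod p) : Party n p (ZMod p) := op .add x y done
def sub (x y : ZMod p) : Party n p (ZMod p) := op .sub x y done
def mul (x y : ZMod p) : Party n p (ZMod p) := op .mul x y done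
def inv (x : ZMod p) : Party n p (ZMod p) := op .inv x 0 done
def random : Party n p (ZMod p) := coin done

def isEq (x y : ZMod p) : Party n p Bool := do
  let z ← op .eq x y done
  return decide (z = 1)

def sum (l : List (ZMod p)) : Party n p (ZMod p) := l.foldlM add 0

/-- `c + ∑ tᵢ sᵢ`. -/
def affine (c : ZMod p) (l : List (ZMod p × ZMod p)) : Party n p (ZMod p) :=
  l.foldlM (fun acc ts => do add acc (← mul ts.1 ts.2)) c

/-- `[y, y x, …, y x ^ (m - 1)]`. -/
def powers (x : ZMod p) : ℕ → ZMod p → Party n p (List (ZMod p))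
  | 0, _ => done []
  | m + 1, y => do
      let l ← powers x m (← mul y x)
      return y :: l

/-- `u - c v`, entry by entry. -/
def subMul (c : ZMod p) : List (ZMod p) → List (ZMod p) → Party n p (List (ZMod p))
  | [], _ => done []
  | u, [] => done u
  | a :: u, b :: v => do
      let x ← sub a (← mul c b)
      let l ← subMul c u v
      return x :: l

/-- The first row whose entry in column `c` is not zero, and the other rows. -/
def findPivot (c : ℕ) : List (List (ZMod p)) →
    Party n p (Option (List (ZMod p) × List (List (ZMod p))))
  | [] => done none
  | r :: rs => do
      if ← isEq (r.getD c 0) 0 then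
        match ← findPivot c rs with
        | none => return none
        | some (t, rest) => return some (t, r :: rest)
      else return some (r, rs)

/-- Gauss-Jordan elimination in the columns `c, …, c + m - 1`. The first list holds the pivot rows
found so far, each with its column. -/
def eliminate : (m c : ℕ) → List (ℕ × List (ZMod p)) → List (List (ZMod p)) →
    Party n p (List (ℕ × List (ZMod p)))
  | 0, _, piv, _ => done piv
  | m + 1, c, piv, rows => do
      match ← findPivot c rows with
      | none => eliminate m (c + 1) piv rows
      | some (r, rest) =>
          let i ← inv (r.getD c 0)
          let r' ← r.mapM (mul i)
          let piv' ← piv.mapM (fun t => do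
            let u ← subMul (t.2.getD c 0) t.2 r'
            return (t.1, u))
          let rest' ← rest.mapM (fun t => subMul (t.getD c 0) t r')
          eliminate m (c + 1) ((c, r') :: piv') rest'

/-- A solution of a consistent linear system with `m` unknowns; each row holds `m` coefficients
and the right-hand side. -/
def solve (m : ℕ) (rows : List (List (ZMod p))) : Party n p (List (ZMod p)) := do
  let piv ← eliminate m 0 [] rows
  return (List.range m).map (fun c =>
    ((piv.find? (fun t => t.1 == c)).elim 0 (fun t => t.2.getD m 0)))

/-- The `m` leading coefficients of the quotient of a polynomial by a monic one with lower
coefficients `e`; coefficients are listed from the highest degree down. -/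
def divide (e : List (ZMod p)) : ℕ → List (ZMod p) → Party n p (List (ZMod p))
  | 0, _ => done []
  | _ + 1, [] => done []
  | m + 1, a :: f => do
      let f' ← subMul a f e
      let l ← divide e m f'
      return a :: l

/-- Value at `x` of the polynomial with the given coefficients, from the highest degree down. -/
def horner (x : ZMod p) (l : List (ZMod p)) : Party n p (ZMod p) :=
  l.foldlM (fun acc a => do add (← mul acc x) a) 0

/-- The decoding algorithm of Berlekamp and Welch: coefficients, from the highest degree down, of
the polynomial of degree at most `d` that agrees with all but at most `(m - d - 1) / 2` of the `m`
given points. One solves `F(xᵢ) = yᵢ E(xᵢ)` for `F` of degree at most `d + e` and for a monic `E`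
of degree `e`, and divides. -/
def berlekampWelch (d : ℕ) (pts : List (ZMod p × ZMod p)) : Party n p (List (ZMod p)) := do
  let e := (pts.length - d - 1) / 2
  let rows ← pts.mapM (fun t => do
    let u ← powers t.1 (d + e + 1) 1
    let v ← powers t.1 (e + 1) t.2
    let v' ← (v.take e).mapM (sub 0)
    return u ++ v' ++ [v.getD e 0])
  let s ← solve (d + e + 1 + e) rows
  divide (s.drop (d + e + 1)).reverse (d + 1) (s.take (d + e + 1)).reverse

/-- Lagrange interpolation at `x` through the given points. -/
def lagrange (pts : List (ZMod p × ZMod p)) (x : ZMod p) : Party n p (ZMod p) := do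
  let terms ← pts.mapM (fun t => pts.foldlM (fun acc u => do
    if ← isEq t.1 u.1 then return acc
    else mul (← mul acc (← sub x u.1)) (← inv (← sub t.1 u.1))) t.2)
  sum terms

/-- The value that occurs in more than half of the list, if there is one. -/
def majority (l : List (ZMod p)) : Party n p (ZMod p) :=
  l.foldlM (fun best a => do
    let eqs ← l.mapM (isEq a)
    return if l.length < 2 * eqs.count true then a else best) 0

end Party

open Party

/-! ### The subprotocols that are used as given -/

/-- Programs on secret-shared values: `S` is the type of shared values, on which a program can
only form affine combinations (`affine c l` is `c + ∑ tᵢ sᵢ`) and run `secure` steps, in which any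
number of multiplications, of generations of random shared values and of openings take place in
parallel. -/
inductive Script (p : ℕ) (S : Type) : Type
  | ret (s : S) : Script p S
  | op (o : FieldOp) (x y : ZMod p) (k : ZMod p → Script p S) : Script p S
  | affine (c : ZMod p) (l : List (ZMod p × S)) (k : S → Script p S) : Script p S
  | secure (m : ℕ) (factors : Fin m → S × S) (r o : ℕ) (opened : Fin o → S)
      (k : (Fin m → S) → (Fin r → S) → (Fin o → ZMod p) → Script p S) : Script p S

namespace Script
variable {p : ℕ} {S : Type}

/-- Multiplications, generations of random values, and openings, in the worst case. -/
noncomputable def invocations : Script p S → ℕ∞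
  | ret _ => 0
  | op o x y k => (k (o.eval x y)).invocations
  | affine _ _ k => ⨆ s, (k s).invocations
  | secure m _ r o _ k => ((m + r + o : ℕ) : ℕ∞) + ⨆ u, ⨆ v, ⨆ w, (k u v w).invocations

/-- Operations outside the `secure` steps, in the worst case. -/
noncomputable def localOps : Script p S → ℕ∞
  | ret _ => 0
  | op o x y k => 1 + (k (o.eval x y)).localOps
  | affine _ l k => ((l.length + 1 : ℕ) : ℕ∞) + ⨆ s, (k s).localOps
  | secure _ _ _ _ _ k => ⨆ u, ⨆ v, ⨆ w, (k u v w).localOps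

/-- Number of `secure` steps, in the worst case. -/
noncomputable def depth : Script p S → ℕ∞
  | ret _ => 0
  | op o x y k => (k (o.eval x y)).depth
  | affine _ _ k => ⨆ s, (k s).depth
  | secure _ _ _ _ _ k => 1 + ⨆ u, ⨆ v, ⨆ w, (k u v w).depth

end Script

/-- The subprotocols taken from elsewhere, for `n` parties, quorums of `N` parties, and the field
`ZMod p`. -/
structure Tools (n N p : ℕ) : Type 1 where
  /-- Quorum building: the program of each party, which returns `n` quorums. -/
  quorums : Fin n → Party n p (Fin n → (Fin N ↪ Fin n))
  /-- Secure broadcast of at most `len` field elements among the parties of `members`: the program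
  of party `me`, which returns the elements broadcast by `sender`. -/
  broadcast (members : Finset (Fin n)) (len : ℕ) (sender me : Fin n) (m : List (ZMod p)) :
    Party n p (List (ZMod p))
  /-- Maximal number of field elements that a party broadcasts in the secret sharing scheme. -/
  vssLen : ℕ
  /-- Verifiable secret sharing among the parties of the quorum `Q` with polynomials of degree
  `deg`: the program of party `me` up to the only broadcast of the scheme. It returns what `me`
  broadcasts, and the program that turns what all parties have broadcast into the share of `me`.
  Only the dealer makes use of `secret`. -/
  vss (Q : Fin N ↪ Fin n) (deg : ℕ) (dealer me : Fin n) (secret : ZMod p) :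
    Party n p (List (ZMod p) × ((Fin n → List (ZMod p)) → Party n p (ZMod p)))
  /-- Secure comparison: the program that computes a sharing of `(r ≤ r')` from `r` and `r'`. -/
  compare (S : Type) (r r' : S) : Script p S

/-- The dealer and the parties of the quorum. -/
def members {n N : ℕ} (Q : Fin N ↪ Fin n) (dealer : Fin n) : Finset (Fin n) :=
  insert dealer (Finset.univ.map Q)

namespace Tools
variable {n N p : ℕ} (T : Tools n N p)

/-- The sharing scheme over a physical broadcast channel. -/
def vssOnChannel (Q : Fin N ↪ Fin n) (deg : ℕ) (dealer me : Fin n) (secret : ZMod p) :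
    Party n p (ZMod p) := do
  let (m, k) ← T.vss Q deg dealer me secret
  let got ← exchange (fun j => if j ∈ members Q dealer then m.take T.vssLen else [])
  k got

/-- The costs of the given subprotocols, with all constants bounded by `κ`: quorum building takes
`O(1)` rounds and `Õ(n)` bits and operations; broadcast takes `O(1)` rounds and is polynomial in
the number of members and the length of the message; verifiable secret sharing takes three rounds,
one of them a broadcast, and is polynomial in `N`; comparison takes `O(1)` rounds of `O(log p)`
invocations of multiplication and the like. -/
structure WithinCosts (κ : ℕ) : Prop where
  quorums_rounds : ∀ i, (T.quorums i).rounds ≤ κ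
  quorums_bits : ∑ i, (T.quorums i).bits ≤ ((κ * n * Nat.log 2 n ^ κ : ℕ) : ℕ∞)
  quorums_ops : ∑ i, (T.quorums i).ops ≤ ((κ * n * Nat.log 2 n ^ κ : ℕ) : ℕ∞)
  broadcast_rounds : ∀ S len, ∀ sender ∈ S, ∀ me ∈ S, ∀ m : List (ZMod p), m.length ≤ len →
    (T.broadcast S len sender me m).rounds ≤ κ
  broadcast_sent : ∀ S len, ∀ sender ∈ S, ∀ me ∈ S, ∀ m : List (ZMod p), m.length ≤ len →
    (T.broadcast S len sender me m).sent ≤ ((κ * ((S.card + 1) * (len + 1)) ^ κ : ℕ) : ℕ∞)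
  broadcast_ops : ∀ S len, ∀ sender ∈ S, ∀ me ∈ S, ∀ m : List (ZMod p), m.length ≤ len →
    (T.broadcast S len sender me m).ops ≤ ((κ * ((S.card + 1) * (len + 1)) ^ κ : ℕ) : ℕ∞)
  vss_len : T.vssLen ≤ κ * (N + 1) ^ κ
  vss_rounds : ∀ Q deg dealer, ∀ me ∈ members Q dealer, ∀ s,
    (T.vssOnChannel Q deg dealer me s).rounds ≤ 3
  vss_sent : ∀ Q deg dealer, ∀ me ∈ members Q dealer, ∀ s, deg ≤ N →
    (T.vssOnChannel Q deg dealer me s).sent ≤ ((κ * (N + 1) ^ κ : ℕ) : ℕ∞)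
  vss_ops : ∀ Q deg dealer, ∀ me ∈ members Q dealer, ∀ s, deg ≤ N →
    (T.vssOnChannel Q deg dealer me s).ops ≤ ((κ * (N + 1) ^ κ : ℕ) : ℕ∞)
  compare_depth : ∀ r r' : ZMod p, (T.compare _ r r').depth ≤ κ
  compare_invocations : ∀ r r' : ZMod p,
    (T.compare _ r r').invocations ≤ ((κ * Nat.clog 2 p : ℕ) : ℕ∞)
  compare_localOps : ∀ r r' : ZMod p,
    (T.compare _ r r').localOps ≤ ((κ * Nat.clog 2 p ^ κ : ℕ) : ℕ∞)

/-! ### The subprotocols of the shuffle -/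

/-- One round of broadcast: each party of `S` broadcasts to `S`. -/
noncomputable def broadcastRound (S : Finset (Fin n)) (len : ℕ) :
    Fin n → List (ZMod p) → Party n p (Fin n → List (ZMod p)) :=
  lockstep (fun me m => parAll n (fun sender =>
    if sender ∈ S ∧ me ∈ S then
      T.broadcast S len sender me (if sender = me then m.take len else [])
    else done []))

/-- Verifiable secret sharing over point-to-point channels: the broadcast is carried out by the
broadcast protocol. Returns the share of `me`. -/
noncomputable def share (Q : Fin N ↪ Fin n) (deg : ℕ) (dealer : Fin n) :
    Fin n → ZMod p → Party n p (ZMod p) :=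
  lockstep (fun me secret =>
    if me ∈ members Q dealer then do
      let (m, k) ← T.vss Q deg dealer me secret
      let got ← T.broadcastRound (members Q dealer) T.vssLen me m
      k got
    else done 0)

/-- The evaluation point of the member `a` of a quorum. -/
def point (a : Fin N) : ZMod p := ((a.val + 1 : ℕ) : ZMod p)

/-- `GenRand`, for the member `a` of `Q`: each member shares a random value, and the shares are
added up. -/
noncomputable def genRand (Q : Fin N ↪ Fin n) (deg : ℕ) (a : Fin N) : Party n p (ZMod p) := do
  let ρ ← random
  let got ← parAll N (fun b => T.share Q deg (Q b) (Q a) (if b = a then ρ else 0))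
  sum (List.ofFn got)

/-- `RenewShares`, for the member `a` of `Q` with the share `s`: a random polynomial of degree
`N / 3` that vanishes at `0` is added. It is `x` times the sum of random polynomials of degree
`N / 3 - 1`, one shared by each member. -/
noncomputable def renewShares (Q : Fin N ↪ Fin n) (a : Fin N) (s : ZMod p) :
    Party n p (ZMod p) := do
  let β ← T.genRand Q (N / 3 - 1) a
  let δ ← mul (point a) β
  add s δ

/-- `Reconst`, for the member `a` of `Q` with the share `s` of a value shared by a polynomial of
degree `N / 3`. Returns the value and the members whose shares were wrong. -/
def reconst (Q : Fin N ↪ Fin n) (s : ZMod p) :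
    Party n p (ZMod p × List (Fin N)) := do
  let d := N / 3
  let got ← exchange (fun j => if j ∈ Finset.univ.map Q then [s] else [])
  let pts : List (ZMod p × ZMod p) := List.ofFn (fun b : Fin N => (point b, (got (Q b)).headD 0))
  let ok ← pts.mapM (fun t => do isEq t.2 (← lagrange (pts.take (d + 1)) t.1))
  if ok.all id then
    let z ← lagrange (pts.take (d + 1)) 0
    return (z, [])
  else
    let φ ← berlekampWelch d pts
    let z ← horner 0 φ
    let right ← pts.mapM (fun t => do isEq t.2 (← horner t.1 φ))
    return (z, (List.finRange N).filter (fun b => !(right.getD b.val true)))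

/-- `Multiply`, for the member `a` of `Q` with the shares `x` and `y`. -/
noncomputable def multiply (Q : Fin N ↪ Fin n) (a : Fin N) (x y : ZMod p) :
    Party n p (ZMod p) := do
  let (u, v) ← par (T.genRand Q (N / 6) a) (T.genRand Q (N / 6) a)
  let w ← mul u v
  let (u, v, w) ← par (T.renewShares Q a u) (par (T.renewShares Q a v) (T.renewShares Q a w))
  let εa ← add x u
  let δa ← add y v
  let (εr, δr) ← par (reconst Q εa) (reconst Q δa)
  let ε := εr.1
  let δ := δr.1
  sub (← affine w [(δ, x), (ε, y)]) (← mul ε δ)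

/-- A program on shared values, run by the member `a` of `Q` on its shares. -/
noncomputable def exec (Q : Fin N ↪ Fin n) (a : Fin N) : Script p (ZMod p) → Party n p (ZMod p)
  | .ret s => done s
  | .op o x y k => .op o x y (fun z => exec Q a (k z))
  | .affine c l k => do
      let s ← affine c l
      exec Q a (k s)
  | .secure m factors r o opened k => do
      let (ps, rs, os) ← par (parAll m (fun i => T.multiply Q a (factors i).1 (factors i).2))
        (par (parAll r (fun _ => T.genRand Q (N / 3) a))
          (parAll o (fun i => reconst Q (opened i))))
      exec Q a (k ps rs (fun i => (os i).1))

/-- Gate computation, for the member `a` of `Q` with the shares `(r, x)` and `(r', x')` of the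
input pairs: comparison, exchange of the pairs if necessary, and renewal of the shares of the
output pairs `(s, y)` and `(s', y')`. -/
noncomputable def gate (Q : Fin N ↪ Fin n) (a : Fin N) (i i' : ZMod p × ZMod p) :
    Party n p ((ZMod p × ZMod p) × (ZMod p × ZMod p)) := do
  let (r, x) := i
  let (r', x') := i'
  let ρ ← T.exec Q a (T.compare _ r r')
  let ρ' ← sub 1 ρ
  let c ← parAll 8 (fun j => T.multiply Q a (![ρ, ρ', ρ, ρ', ρ, ρ', ρ, ρ'] j)
    (![r, r', x, x', r', r, x', x] j))
  let s ← add (c 0) (c 1)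
  let y ← add (c 2) (c 3)
  let s' ← add (c 4) (c 5)
  let y' ← add (c 6) (c 7)
  let o ← parAll 4 (fun j => T.renewShares Q a (![s, y, s', y'] j))
  return ((o 0, o 1), (o 2, o 3))

end Tools

/-! ### Comparator networks and the main protocol -/

/-- A comparator network on `n` wires: a list of levels, each a list of comparators on disjoint
wires. The comparator `(v, w)` puts the smaller value on `v`. -/
structure Network (n : ℕ) where
  levels : List (List (Fin n × Fin n))
  disjoint : ∀ L ∈ levels, (L.map Prod.fst ++ L.map Prod.snd).Nodup

namespace Network
variable {n : ℕ}

def depth (G : Network n) : ℕ := G.levels.length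

/-- Position, in a level, of the comparator on the wire `w`. -/
def find (w : Fin n) (L : List (Fin n × Fin n)) : Option ℕ :=
  L.findIdx? (fun g => decide (g.1 = w) || decide (g.2 = w))

/-- Number of the first gate on the wire `w`; the gates of the given levels are numbered from
`i` on. -/
def firstGate (w : Fin n) : ℕ → List (List (Fin n × Fin n)) → Option ℕ
  | _, [] => none
  | i, L :: Ls => ((find w L).map (i + ·)).or (firstGate w (i + L.length) Ls)

/-- Number of the last gate on the wire `w`. -/
def lastGate (w : Fin n) : ℕ → List (List (Fin n × Fin n)) → Option ℕ
  | _, [] => none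
  | i, L :: Ls => (lastGate w (i + L.length) Ls).or ((find w L).map (i + ·))

/-- The gate whose quorum receives the input on the wire `w`. -/
def inputGate (G : Network n) (w : Fin n) : ℕ := (firstGate w 0 G.levels).getD (w.val / 2)

/-- The gate whose quorum holds the output on the wire `w`. -/
def outputGate (G : Network n) (w : Fin n) : ℕ := (lastGate w 0 G.levels).getD (w.val / 2)

end Network

open Network

namespace Tools
variable {n N p : ℕ} [NeZero n] (T : Tools n N p)

/-- Run `f a` if `me` is the member `a` of `Q`, and do nothing otherwise. -/
noncomputable def asMember {α : Type} (Q : Fin N ↪ Fin n) (me : Fin n) (dflt : α)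
    (f : Fin N → Party n p α) : Party n p α :=
  open Classical in if h : ∃ a, Q a = me then f h.choose else done dflt

/-- The shares that a party holds, for each wire: of the random key and of the message. -/
abbrev Shares (n p : ℕ) : Type := Fin n → ZMod p × ZMod p

/-- The quorum of the gate with number `i`. -/
def quorumOf (Q : Fin n → (Fin N ↪ Fin n)) (i : ℕ) : Fin N ↪ Fin n := Q (Fin.ofNat n i)

/-- Input sharing and random generation. -/
noncomputable def inputs (Q : Fin n → (Fin N ↪ Fin n)) (G : Network n) (x : Fin n → ZMod p)
    (me : Fin n) : Party n p (Shares n p) := do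
  let xs ← lockstep (fun me (_ : Unit) => parAll n (fun w =>
    T.share (quorumOf Q (G.inputGate w)) (N / 3) w me (if w = me then x w else 0))) me ()
  let rs ← lockstep (fun me (_ : Unit) => parAll n (fun w =>
    asMember (quorumOf Q (G.inputGate w)) me 0
      (fun a => T.genRand (quorumOf Q (G.inputGate w)) (N / 3) a))) me ()
  return fun w => (rs w, xs w)

/-- The member `a` of `Q` sends its share of a pair to the member `a` of `Q'`; returns the shares
that `me` holds afterwards. -/
noncomputable def forward (Q Q' : Fin N ↪ Fin n) (me : Fin n) (v : ZMod p × ZMod p) :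
    Party n p (ZMod p × ZMod p) := do
  let got ← exchange (fun j => open Classical in
    if ∃ a, Q a = me ∧ Q' a = j then [v.1, v.2] else [])
  asMember Q' me v (fun a => done ((got (Q a)).getD 0 0, (got (Q a)).getD 1 0))

/-- Evaluation of the level `L`, whose gates are numbered from `i` on; `Ls` are the levels above.
The outputs go to the quorum of the next gate on the wire, if there is one. -/
noncomputable def level (Q : Fin n → (Fin N ↪ Fin n)) (i : ℕ) (L : List (Fin n × Fin n))
    (Ls : List (List (Fin n × Fin n))) (me : Fin n) (st : Shares n p) :
    Party n p (Shares n p) := do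
  let out ← lockstep (fun me (st : Shares n p) => parAll L.length (fun j =>
    asMember (quorumOf Q (i + j)) me (0, 0) (fun a =>
      T.gate (quorumOf Q (i + j)) a (st (L.get j).1) (st (L.get j).2)))) me st
  let next := fun (j : Fin L.length) (w : Fin n) =>
    quorumOf Q ((firstGate w (i + L.length) Ls).getD (i + j))
  let new ← parAll L.length (fun j =>
    par (forward (quorumOf Q (i + j)) (next j (L.get j).1) me (out j).1)
      (forward (quorumOf Q (i + j)) (next j (L.get j).2) me (out j).2))
  return (List.finRange L.length).foldl (fun s j =>
    Function.update (Function.update s (L.get j).1 (new j).1) (L.get j).2 (new j).2) st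

/-- Circuit computation, level by level. -/
noncomputable def circuit (Q : Fin n → (Fin N ↪ Fin n)) (me : Fin n) :
    ℕ → List (List (Fin n × Fin n)) → Shares n p → Party n p (Shares n p)
  | _, [], st => done st
  | i, L :: Ls, st => do
      let st' ← T.level Q i L Ls me st
      circuit Q me (i + L.length) Ls st'

/-- The shuffle: input sharing, random generation and circuit computation. -/
noncomputable def shuffle (Q : Fin n → (Fin N ↪ Fin n)) (G : Network n) (x : Fin n → ZMod p)
    (me : Fin n) : Party n p (Shares n p) := do
  let st ← T.inputs Q G x me
  T.circuit Q me 0 G.levels st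

/-- Output propagation: the output quorums reconstruct the messages and send them to all parties,
who take the majority of what they receive. -/
noncomputable def output (Q : Fin n → (Fin N ↪ Fin n)) (G : Network n) (me : Fin n)
    (st : Shares n p) : Party n p (Fin n → ZMod p) := do
  let z ← lockstep (fun me (st : Shares n p) => parAll n (fun w =>
    asMember (quorumOf Q (G.outputGate w)) me (0, [])
      (fun _ => reconst (quorumOf Q (G.outputGate w)) (st w).2))) me st
  parAll n (fun w => do
    let got ← exchange (fun _ => open Classical in
      if ∃ a, quorumOf Q (G.outputGate w) a = me then [(z w).1] else [])
    majority (List.ofFn (fun a => (got (quorumOf Q (G.outputGate w) a)).headD 0)))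

/-- Rounds of `AnonymousBroadcast`, output propagation included, in a run in which quorum building
returns the quorums `Q`. -/
noncomputable def totalRounds (Q : Fin n → (Fin N ↪ Fin n)) (G : Network n) (x : Fin n → ZMod p) :
    ℕ∞ :=
  (⨆ i, (T.quorums i).rounds) + ⨆ i, ((T.shuffle Q G x i).bind (output Q G i)).rounds

/-- Bits sent by all parties for quorum building and the shuffle. -/
noncomputable def totalBits (Q : Fin n → (Fin N ↪ Fin n)) (G : Network n) (x : Fin n → ZMod p) :
    ℕ∞ :=
  ∑ i, ((T.quorums i).bits + (T.shuffle Q G x i).bits)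

/-- Operations computed by all parties for quorum building and the shuffle. -/
noncomputable def totalOps (Q : Fin n → (Fin N ↪ Fin n)) (G : Network n) (x : Fin n → ZMod p) :
    ℕ∞ :=
  ∑ i, ((T.quorums i).ops + (T.shuffle Q G x i).ops)

/-- Field elements sent by all parties for output propagation. -/
noncomputable def outputSent (p : ℕ) (Q : Fin n → (Fin N ↪ Fin n)) (G : Network n) : ℕ∞ :=
  ∑ i, ⨆ st : Shares n p, (output Q G i st).sent

end Tools

end AnonBroadcast

namespace AnonBroadcast

/-! The costs are small because all interaction is local to quorums. A gate is evaluated inside one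
quorum of `N = O(log n)` parties by a bounded number of parallel phases, and each phase is
polynomial in `N` and in the length `O(log n)` of a field element. Hence a gate costs polylog(n). A
level has at most `n` gates and there are `O(log n)` levels, so the circuit costs `Õ(n)`; input
sharing costs polylog(n) per wire. Gates of a level run in parallel, so a level takes `O(1)` rounds.
In the output step `N` members for each of `n` wires send to `n` parties, which gives `n² log n`.

A program is a tree, and its costs are suprema over the branches. `Costs` is a compositional
calculus for such bounds: sequencing adds all three costs (`Costs.bind`), parallel sessions add
traffic and operations but share rounds (`Costs.par`, `Costs.parAll`), and waiting for the slowest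
party is free except for rounds (`Costs.lockstep`). Postconditions record lengths of returned lists,
on which the cost of later local computation depends.

Three points need more than composition. The sharing scheme is only known to be cheap over a
physical broadcast channel, so `share_takes` compares the two programs branch by branch. A single
party may belong to many quorums and then has no polylogarithmic bound of its own; the bounds
therefore depend on the party, and are summed by double counting over quorums (`sum_memberCost`).
Finally the explicit bound `wireLoad` is a polynomial expression in `N`, the bit length and the
depth, hence at most a monomial in `log n` (`PolyBounded.wireLoad`). -/

instance (p : ℕ) : Nonempty (Msg p) := ⟨.empty⟩

namespace Party
variable {n p : ℕ} {α β γ σ : Type}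

/-! ### Cost bounds with postconditions -/

/-- Every value that the program may return satisfies `post`. -/
def Returns (post : α → Prop) : Party n p α → Prop
  | done a => post a
  | op o x y k => (k (o.eval x y)).Returns post
  | coin k => ∀ z, (k z).Returns post
  | comm _ k => ∀ inbox, (k inbox).Returns post

/-- The program takes at most `r` rounds, sends at most `s` field elements, computes at most `o`
operations, and returns only values that satisfy `post`. -/
structure Costs (P : Party n p α) (r s o : ℕ) (post : α → Prop) : Prop where
  rounds_le : P.rounds ≤ r
  sent_le : P.sent ≤ s
  ops_le : P.ops ≤ o
  returns : P.Returns post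

/-- A cost bound without a postcondition. -/
abbrev Takes (P : Party n p α) (r s o : ℕ) : Prop := P.Costs r s o (fun _ => True)

theorem returns_true (P : Party n p α) : P.Returns (fun _ => True) := by
  induction P with
  | done a => trivial
  | op o x y k ih => exact ih _
  | coin k ih => exact ih
  | comm out k ih => exact ih

theorem Returns.imp {post post' : α → Prop} (h : ∀ a, post a → post' a) {P : Party n p α}
    (hP : P.Returns post) : P.Returns post' := by
  induction P with
  | done a => exact h _ hP
  | op o x y k ih => exact ih _ hP
  | coin k ih => exact fun z => ih z (hP z)
  | comm out k ih => exact fun z => ih z (hP z)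

theorem bind_done (P : Party n p α) : P.bind done = P := by
  induction P with
  | done a => rfl
  | op o x y k ih => simp only [bind, ih]
  | coin k ih => simp only [bind, ih]
  | comm out k ih => simp only [bind, ih]

theorem bind_assoc (P : Party n p α) (f : α → Party n p β) (g : β → Party n p γ) :
    (P.bind f).bind g = P.bind (fun a => (f a).bind g) := by
  induction P with
  | done a => rfl
  | op o x y k ih => simp only [bind, ih]
  | coin k ih => simp only [bind, ih]
  | comm out k ih => simp only [bind, ih]

instance : LawfulMonad (Party n p) :=
  LawfulMonad.mk' _ (fun P => bind_done P) (fun _ _ => rfl) bind_assoc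

/-- The bound on the continuation is needed only at values that can be returned; being uniform
there, it can be pulled out of every supremum over coins and inboxes. -/
theorem rounds_bind_le {post : α → Prop} {P : Party n p α} (hP : P.Returns post)
    {f : α → Party n p β} {c : ℕ∞} (hf : ∀ a, post a → (f a).rounds ≤ c) :
    (P.bind f).rounds ≤ P.rounds + c := by
  induction P with
  | done a => simpa [bind, rounds] using hf a hP
  | op o x y k ih => exact ih _ hP
  | coin k ih =>
      exact iSup_le fun z => (ih z (hP z)).trans (by gcongr; exact le_iSup (fun z => (k z).rounds) z)
  | comm out k ih =>
      simp only [bind, rounds, add_assoc]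
      gcongr
      exact iSup_le fun z => (ih z (hP z)).trans (by gcongr; exact le_iSup (fun z => (k z).rounds) z)

theorem sent_bind_le {post : α → Prop} {P : Party n p α} (hP : P.Returns post)
    {f : α → Party n p β} {c : ℕ∞} (hf : ∀ a, post a → (f a).sent ≤ c) :
    (P.bind f).sent ≤ P.sent + c := by
  induction P with
  | done a => simpa [bind, sent] using hf a hP
  | op o x y k ih => exact ih _ hP
  | coin k ih =>
      exact iSup_le fun z => (ih z (hP z)).trans (by gcongr; exact le_iSup (fun z => (k z).sent) z)
  | comm out k ih =>
      simp only [bind, sent, add_assoc]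
      gcongr
      exact iSup_le fun z => (ih z (hP z)).trans (by gcongr; exact le_iSup (fun z => (k z).sent) z)

theorem ops_bind_le {post : α → Prop} {P : Party n p α} (hP : P.Returns post)
    {f : α → Party n p β} {c : ℕ∞} (hf : ∀ a, post a → (f a).ops ≤ c) :
    (P.bind f).ops ≤ P.ops + c := by
  induction P with
  | done a => simpa [bind, ops] using hf a hP
  | op o x y k ih =>
      simp only [bind, ops, add_assoc]
      gcongr
      exact ih _ hP
  | coin k ih =>
      simp only [bind, ops, add_assoc]
      gcongr
      exact iSup_le fun z => (ih z (hP z)).trans (by gcongr; exact le_iSup (fun z => (k z).ops) z)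
  | comm out k ih =>
      exact iSup_le fun z => (ih z (hP z)).trans (by gcongr; exact le_iSup (fun z => (k z).ops) z)

theorem Returns.bind {post : α → Prop} {post' : β → Prop} {P : Party n p α} (hP : P.Returns post)
    {f : α → Party n p β} (hf : ∀ a, post a → (f a).Returns post') :
    (P.bind f).Returns post' := by
  induction P with
  | done a => exact hf a hP
  | op o x y k ih => exact ih _ hP
  | coin k ih => exact fun z => ih z (hP z)
  | comm out k ih => exact fun z => ih z (hP z)

/-- Replacing the continuation of a program by one that takes `c` more rounds. -/
theorem rounds_bind_le_add {P : Party n p α} {f : α → Party n p β} {g : α → Party n p γ} {c : ℕ∞}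
    (h : ∀ a, (g a).rounds ≤ c + (f a).rounds) : (P.bind g).rounds ≤ c + (P.bind f).rounds := by
  induction P with
  | done a => exact h a
  | op o x y k ih => exact ih _
  | coin k ih =>
      exact iSup_le fun z => (ih z).trans
        (by gcongr; exact le_iSup (fun z => ((k z).bind f).rounds) z)
  | comm out k ih =>
      simp only [bind, rounds]
      rw [add_left_comm]
      gcongr
      exact iSup_le fun z => (ih z).trans
        (by gcongr; exact le_iSup (fun z => ((k z).bind f).rounds) z)

/-- Comparing two continuations leaf by leaf requires no bound on `P` alone. This suits `share`,
where only the whole program `vssOnChannel` has a known cost. -/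
theorem sent_bind_le_add {P : Party n p α} {f : α → Party n p β} {g : α → Party n p γ} {c : ℕ∞}
    (h : ∀ a, (g a).sent ≤ c + (f a).sent) : (P.bind g).sent ≤ c + (P.bind f).sent := by
  induction P with
  | done a => exact h a
  | op o x y k ih => exact ih _
  | coin k ih =>
      exact iSup_le fun z => (ih z).trans
        (by gcongr; exact le_iSup (fun z => ((k z).bind f).sent) z)
  | comm out k ih =>
      simp only [bind, sent]
      rw [add_left_comm]
      gcongr
      exact iSup_le fun z => (ih z).trans
        (by gcongr; exact le_iSup (fun z => ((k z).bind f).sent) z)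

theorem ops_bind_le_add {P : Party n p α} {f : α → Party n p β} {g : α → Party n p γ} {c : ℕ∞}
    (h : ∀ a, (g a).ops ≤ c + (f a).ops) : (P.bind g).ops ≤ c + (P.bind f).ops := by
  induction P with
  | done a => exact h a
  | op o x y k ih =>
      simp only [bind, ops]
      rw [add_left_comm]
      gcongr
      exact ih _
  | coin k ih =>
      simp only [bind, ops]
      rw [add_left_comm]
      gcongr
      exact iSup_le fun z => (ih z).trans
        (by gcongr; exact le_iSup (fun z => ((k z).bind f).ops) z)
  | comm out k ih =>
      exact iSup_le fun z => (ih z).trans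
        (by gcongr; exact le_iSup (fun z => ((k z).bind f).ops) z)

/-! ### Parallel sessions -/

theorem rounds_parDone (a : α) (q : Party n p β) : (parDone a q).rounds = q.rounds := by
  induction q with
  | done b => rfl
  | op o x y k ih => exact ih _
  | coin k ih => simp only [parDone, rounds, ih]
  | comm out k ih =>
      simp only [parDone, rounds, ih]
      congr 1
      apply le_antisymm
      · exact iSup_le fun z => le_iSup (fun z => (k z).rounds) _
      -- Every inbox is the right half of an inbox of pairs, so no branch of the second session is
      -- lost.
      · exact iSup_le fun z =>
          le_iSup (fun z : Fin n → Msg p => (k fun j => (z j).right).rounds) (fun j => .pair .empty (z j))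

theorem sent_parDone_le (a : α) (q : Party n p β) : (parDone a q).sent ≤ q.sent := by
  induction q with
  | done b => exact le_rfl
  | op o x y k ih => exact ih _
  | coin k ih => exact iSup_mono ih
  | comm out k ih =>
      simp only [parDone, sent, Msg.size, zero_add]
      refine add_le_add le_rfl ?_
      exact iSup_le fun z => (ih _).trans (le_iSup (fun z => (k z).sent) _)

theorem ops_parDone_le (a : α) (q : Party n p β) : (parDone a q).ops ≤ q.ops := by
  induction q with
  | done b => exact le_rfl
  | op o x y k ih => simp only [parDone, ops]; gcongr; exact ih _
  | coin k ih => simp only [parDone, ops]; gcongr; exact ih _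
  | comm out k ih =>
      exact iSup_le fun z => (ih _).trans (le_iSup (fun z => (k z).ops) _)

/-- The nested induction follows `par` and `parComm`: once the first session waits at a round, the
second advances until its own next round. The two rounds are then merged, whence `1 + max` and not a
sum. -/
theorem rounds_par_le (P : Party n p α) (q : Party n p β) :
    (P.par q).rounds ≤ max P.rounds q.rounds := by
  induction P generalizing q with
  | done a => simp [par, rounds, rounds_parDone]
  | op o x y k ih => exact ih _ q
  | coin k ih =>
      exact iSup_le fun z => (ih z q).trans
        (by gcongr; exact le_iSup (fun z => (k z).rounds) z)
  | comm out k ih =>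
      simp only [par]
      induction q with
      | done b =>
          simp only [parComm, rounds, zero_le, sup_of_le_left]
          refine add_le_add le_rfl ?_
          refine iSup_le fun z => (ih _ _).trans ?_
          simpa [rounds] using le_iSup (fun z => (k z).rounds) _
      | op o x y k' ih' => exact ih' _
      | coin k' ih' =>
          exact iSup_le fun z => (ih' z).trans
            (by gcongr; exact le_iSup (fun z => (k' z).rounds) z)
      | comm out' k' ih' =>
          simp only [parComm, rounds]
          rw [max_add_add_left]
          gcongr
          exact iSup_le fun z => (ih _ _).trans (by
            gcongr
            · exact le_iSup (fun z => (k z).rounds) _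
            · exact le_iSup (fun z => (k' z).rounds) _)

theorem sent_par_le (P : Party n p α) (q : Party n p β) :
    (P.par q).sent ≤ P.sent + q.sent := by
  induction P generalizing q with
  | done a => simpa [par, sent] using sent_parDone_le a q
  | op o x y k ih => exact ih _ q
  | coin k ih =>
      exact iSup_le fun z => (ih z q).trans
        (by gcongr; exact le_iSup (fun z => (k z).sent) z)
  | comm out k ih =>
      simp only [par]
      induction q with
      | done b =>
          simp only [parComm, sent, Msg.size, add_zero]
          refine add_le_add le_rfl ?_
          refine iSup_le fun z => (ih _ _).trans ?_
          simpa [sent] using le_iSup (fun z => (k z).sent) _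
      | op o x y k' ih' => exact ih' _
      | coin k' ih' =>
          exact iSup_le fun z => (ih' z).trans
            (by gcongr; exact le_iSup (fun z => (k' z).sent) z)
      | comm out' k' ih' =>
          simp only [parComm, sent, Msg.size, Finset.sum_add_distrib, Nat.cast_add]
          rw [add_add_add_comm]
          gcongr
          exact iSup_le fun z => (ih _ _).trans (by
            gcongr
            · exact le_iSup (fun z => (k z).sent) _
            · exact le_iSup (fun z => (k' z).sent) _)

theorem ops_par_le (P : Party n p α) (q : Party n p β) :
    (P.par q).ops ≤ P.ops + q.ops := by
  induction P generalizing q with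
  | done a => simpa [par, ops] using ops_parDone_le a q
  | op o x y k ih => simp only [par, ops, add_assoc]; gcongr; exact ih _ q
  | coin k ih =>
      simp only [par, ops, add_assoc]
      gcongr
      exact iSup_le fun z => (ih z q).trans
        (by gcongr; exact le_iSup (fun z => (k z).ops) z)
  | comm out k ih =>
      simp only [par]
      induction q with
      | done b =>
          simp only [parComm, ops, add_zero]
          refine iSup_le fun z => (ih _ _).trans ?_
          simpa [ops] using le_iSup (fun z => (k z).ops) _
      | op o x y k' ih' =>
          simp only [parComm, ops]
          rw [add_left_comm]
          gcongr
          exact ih' _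
      | coin k' ih' =>
          simp only [parComm, ops]
          rw [add_left_comm]
          refine add_le_add le_rfl ?_
          exact iSup_le fun z => (ih' z).trans
            (add_le_add le_rfl (le_iSup (fun z => (k' z).ops) z))
      | comm out' k' ih' =>
          simp only [parComm, ops]
          exact iSup_le fun z => (ih _ _).trans (by
            gcongr
            · exact le_iSup (fun z => (k z).ops) _
            · exact le_iSup (fun z => (k' z).ops) _)

/-! ### Idle rounds -/

theorem rounds_idle (a : α) (R : ℕ) : (idle a R : Party n p α).rounds = R := by
  induction R with
  | zero => rfl
  | succ R ih => simp only [idle, rounds, ih, iSup_const]; push_cast; rw [add_comm]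

theorem sent_idle (a : α) (R : ℕ) : (idle a R : Party n p α).sent = 0 := by
  induction R with
  | zero => rfl
  | succ R ih => simp [idle, sent, ih, Msg.size]

theorem ops_idle (a : α) (R : ℕ) : (idle a R : Party n p α).ops = 0 := by
  induction R with
  | zero => rfl
  | succ R ih => simp [idle, ops, ih]

theorem rounds_pad_le (P : Party n p α) (R : ℕ) : (P.pad R).rounds ≤ max P.rounds R := by
  induction P generalizing R with
  | done a => simp [pad, rounds_idle]
  | op o x y k ih => exact ih _ R
  | coin k ih =>
      exact iSup_le fun z => (ih z R).trans
        (by gcongr; exact le_iSup (fun z => (k z).rounds) z)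
  | comm out k ih =>
      simp only [pad, rounds]
      have h : ⨆ z, ((k z).pad (R - 1)).rounds ≤ max (⨆ z, (k z).rounds) ((R - 1 : ℕ) : ℕ∞) :=
        iSup_le fun z => (ih z _).trans
          (by gcongr; exact le_iSup (fun z => (k z).rounds) z)
      -- For `R = 0` the truncated `R - 1` is again `0`, and padding adds nothing.
      rcases R with _ | R
      · simpa using h
      · calc _ ≤ 1 + max (⨆ z, (k z).rounds) ((R : ℕ) : ℕ∞) := by gcongr; exact h
          _ = _ := by rw [← max_add_add_left]; push_cast; rw [add_comm (R : ℕ∞)]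

theorem sent_pad_le (P : Party n p α) (R : ℕ) : (P.pad R).sent ≤ P.sent := by
  induction P generalizing R with
  | done a => simp [pad, sent_idle]
  | op o x y k ih => exact ih _ R
  | coin k ih => exact iSup_mono fun z => ih z R
  | comm out k ih => simp only [pad, sent]; gcongr; exact ih _ _

theorem ops_pad_le (P : Party n p α) (R : ℕ) : (P.pad R).ops ≤ P.ops := by
  induction P generalizing R with
  | done a => simp [pad, ops_idle]
  | op o x y k ih => simp only [pad, ops]; gcongr; exact ih _ _
  | coin k ih => simp only [pad, ops]; gcongr; exact ih _ _
  | comm out k ih => exact iSup_mono fun z => ih z _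

/-! ### Rules for cost bounds -/

namespace Costs

theorem imp {P : Party n p α} {r s o : ℕ} {post post' : α → Prop} (hP : P.Costs r s o post)
    (h : ∀ a, post a → post' a) : P.Costs r s o post' :=
  ⟨hP.rounds_le, hP.sent_le, hP.ops_le, hP.returns.imp h⟩

theorem mono {P : Party n p α} {r s o r' s' o' : ℕ} {post : α → Prop} (hP : P.Costs r s o post)
    (hr : r ≤ r') (hs : s ≤ s') (ho : o ≤ o') : P.Costs r' s' o' post :=
  ⟨hP.rounds_le.trans (by gcongr), hP.sent_le.trans (by gcongr), hP.ops_le.trans (by gcongr),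
    hP.returns⟩

theorem done {a : α} {post : α → Prop} (h : post a) :
    (Party.done a : Party n p α).Costs 0 0 0 post :=
  ⟨by simp [rounds], by simp [sent], by simp [ops], h⟩

theorem pure {a : α} {post : α → Prop} (h : post a) :
    (Pure.pure a : Party n p α).Costs 0 0 0 post :=
  Costs.done h

theorem op_done {f : FieldOp} {x y : ZMod p} : (Party.op f x y Party.done : Party n p _).Takes 0 0 1 :=
  ⟨by simp [rounds], by simp [sent], by simp [ops], trivial⟩

theorem random : (Party.random : Party n p _).Takes 0 0 1 :=
  ⟨by simp [Party.random, rounds], by simp [Party.random, sent], by simp [Party.random, ops],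
    fun _ => trivial⟩

theorem bind {P : Party n p α} {f : α → Party n p β} {r s o r' s' o' : ℕ} {post : α → Prop}
    {post' : β → Prop} (hP : P.Costs r s o post)
    (hf : ∀ a, post a → (f a).Costs r' s' o' post') :
    (P >>= f).Costs (r + r') (s + s') (o + o') post' where
  rounds_le := (rounds_bind_le hP.returns fun a ha => (hf a ha).rounds_le).trans
    (by push_cast; gcongr; exact hP.rounds_le)
  sent_le := (sent_bind_le hP.returns fun a ha => (hf a ha).sent_le).trans
    (by push_cast; gcongr; exact hP.sent_le)
  ops_le := (ops_bind_le hP.returns fun a ha => (hf a ha).ops_le).trans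
    (by push_cast; gcongr; exact hP.ops_le)
  returns := hP.returns.bind fun a ha => (hf a ha).returns

theorem par {P : Party n p α} {P' : Party n p β} {r s o s' o' : ℕ} {post : α → Prop}
    {post' : β → Prop} (hP : P.Costs r s o post) (hP' : P'.Costs r s' o' post') :
    (P.par P').Takes r (s + s') (o + o') where
  rounds_le := (rounds_par_le P P').trans (max_le hP.rounds_le hP'.rounds_le)
  sent_le := (sent_par_le P P').trans (by push_cast; exact add_le_add hP.sent_le hP'.sent_le)
  ops_le := (ops_par_le P P').trans (by push_cast; exact add_le_add hP.ops_le hP'.ops_le)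
  returns := returns_true _

/-- Traffic and operations may vary with the session, because a party is active only in the sessions
of its own quorums. -/
theorem parAll {m : ℕ} {f : Fin m → Party n p α} {r : ℕ} {s o : Fin m → ℕ} {post : α → Prop}
    (h : ∀ i, (f i).Costs r (s i) (o i) post) :
    (Party.parAll m f).Takes r (∑ i, s i) (∑ i, o i) := by
  induction m with
  | zero => exact (Costs.done trivial).mono (Nat.zero_le _) (Nat.zero_le _) (Nat.zero_le _)
  | succ m ih =>
      rw [Fin.sum_univ_succ, Fin.sum_univ_succ]
      exact ((h 0).par (ih fun i => h i.succ)).bind fun _ _ =>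
        (Costs.pure trivial : Costs _ 0 0 0 _)

theorem parAll_const {m : ℕ} {f : Fin m → Party n p α} {r s o : ℕ} {post : α → Prop}
    (h : ∀ i, (f i).Costs r s o post) : (Party.parAll m f).Takes r (m * s) (m * o) := by
  simpa using parAll h

/-- The padding length is a supremum over all parties and states, so rounds must be bounded
uniformly. Idle rounds send and compute nothing, so the other two bounds may remain specific to
`me`. -/
theorem lockstep {step : Fin n → σ → Party n p α} {r s o : ℕ} {post : α → Prop} {me : Fin n} {x : σ}
    (hr : ∀ i y, (step i y).rounds ≤ r) (h : (step me x).Costs r s o post) :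
    (Party.lockstep step me x).Takes r s o where
  rounds_le := (rounds_pad_le _ _).trans (max_le h.rounds_le (by
    have : ⨆ i, ⨆ y, (step i y).rounds ≤ (r : ℕ∞) := iSup_le fun i => iSup_le fun y => hr i y
    exact_mod_cast ENat.toNat_le_of_le_natCast this))
  sent_le := (sent_pad_le _ _).trans h.sent_le
  ops_le := (ops_pad_le _ _).trans h.ops_le
  returns := returns_true _

theorem exchange {out : Fin n → List (ZMod p)} :
    (Party.exchange out).Takes 1 (∑ j, (out j).length) 0 where
  rounds_le := by simp [Party.exchange, rounds]
  sent_le := by simp [Party.exchange, sent, Msg.size]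
  ops_le := by simp [Party.exchange, ops]
  returns := returns_true _

theorem ite {c : Prop} [Decidable c] {P P' : Party n p α} {r s o : ℕ} {post : α → Prop}
    (h : c → P.Costs r s o post) (h' : ¬c → P'.Costs r s o post) :
    (if c then P else P').Costs r s o post := by
  split_ifs with hc
  · exact h hc
  · exact h' hc

theorem mapM {ι : Type} {f : ι → Party n p α} {o : ℕ} {post : α → Prop} {l : List ι}
    (h : ∀ a ∈ l, (f a).Costs 0 0 o post) :
    (l.mapM f).Costs 0 0 (l.length * o) (fun l' => l'.length = l.length ∧ ∀ b ∈ l', post b) := by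
  induction l with
  | nil => simpa using Costs.pure (by simp)
  | cons a l ih =>
      rw [List.mapM_cons]
      have h1 := h a (by simp)
      have h2 := ih fun b hb => h b (by simp [hb])
      refine ((h1.bind fun b hb => h2.bind fun l' hl' => Costs.pure ?_).mono
        le_rfl le_rfl ?_)
      · simpa [hl'.1, hb] using hl'.2
      · simp [add_mul, add_comm]

theorem foldlM {ι : Type} {f : α → ι → Party n p α} {o : ℕ} {l : List ι}
    (h : ∀ a, ∀ i ∈ l, (f a i).Takes 0 0 o) (a : α) :
    (l.foldlM f a).Takes 0 0 (l.length * o) := by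
  induction l generalizing a with
  | nil => simpa using Costs.pure trivial
  | cons i l ih =>
      rw [List.foldlM_cons]
      exact ((h a i (by simp)).bind fun b _ => ih (fun c j hj => h c j (by simp [hj])) b).mono
        le_rfl le_rfl (by simp [add_mul, add_comm])

end Costs

end Party

namespace Party
variable {n p : ℕ} {α β γ σ : Type}

/-! ### Costs of local computation -/

theorem add_takes (x y : ZMod p) : (add x y : Party n p _).Takes 0 0 1 := Costs.op_done
theorem sub_takes (x y : ZMod p) : (sub x y : Party n p _).Takes 0 0 1 := Costs.op_done
theorem mul_takes (x y : ZMod p) : (mul x y : Party n p _).Takes 0 0 1 := Costs.op_done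
theorem inv_takes (x : ZMod p) : (inv x : Party n p _).Takes 0 0 1 := Costs.op_done

theorem isEq_takes (x y : ZMod p) : (isEq x y : Party n p _).Takes 0 0 1 :=
  Costs.op_done.bind fun _ _ => (Costs.pure trivial : Costs _ 0 0 0 _)

theorem sum_takes (l : List (ZMod p)) : (sum l : Party n p _).Takes 0 0 l.length :=
  (Costs.foldlM (fun _ _ _ => add_takes _ _) 0).mono le_rfl le_rfl (mul_one _).le

theorem affine_takes (c : ZMod p) (l : List (ZMod p × ZMod p)) :
    (affine c l : Party n p _).Takes 0 0 (l.length * 2) :=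
  Costs.foldlM (fun _ _ _ => (mul_takes _ _).bind fun _ _ => add_takes _ _) c

theorem horner_takes (x : ZMod p) (l : List (ZMod p)) :
    (horner x l : Party n p _).Takes 0 0 (l.length * 2) :=
  Costs.foldlM (fun _ _ _ => (mul_takes _ _).bind fun _ _ => add_takes _ _) 0

theorem majority_takes (l : List (ZMod p)) :
    (majority l : Party n p _).Takes 0 0 (l.length * l.length) :=
  Costs.foldlM (fun _ _ _ => ((Costs.mapM fun _ _ => isEq_takes _ _).bind fun _ _ =>
    Costs.pure trivial).mono le_rfl le_rfl (by simp)) 0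

theorem powers_costs (x : ZMod p) (m : ℕ) (y : ZMod p) :
    (powers x m y : Party n p _).Costs 0 0 m (fun l => l.length = m) := by
  induction m generalizing y with
  | zero => exact Costs.done rfl
  | succ m ih =>
      exact ((mul_takes y x).bind fun z _ => (ih z).bind fun l hl =>
        Costs.pure (by simp [hl])).mono le_rfl le_rfl (by omega)

/-- The length is that of `u` whatever the length of `v`, so row operations never widen a row. -/
theorem subMul_costs (c : ZMod p) (u v : List (ZMod p)) :
    (subMul c u v : Party n p _).Costs 0 0 (u.length * 2) (fun l => l.length = u.length) := by
  induction u generalizing v with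
  | nil => rw [subMul]; exact (Costs.done (by rfl)).mono le_rfl le_rfl (Nat.zero_le _)
  | cons a u ih =>
      cases v with
      | nil => rw [subMul.eq_2 _ _ (by simp)]; exact (Costs.done (by rfl)).mono le_rfl le_rfl (Nat.zero_le _)
      | cons b v =>
          exact ((mul_takes c b).bind fun z _ => (sub_takes a z).bind fun y _ =>
            (ih v).bind fun l hl => Costs.pure (by simp [hl])).mono le_rfl le_rfl
              (by simp only [List.length_cons]; omega)

/-- The rows of a matrix with at most `w` columns. -/
def RowsLE (w : ℕ) (rows : List (List (ZMod p))) : Prop := ∀ r ∈ rows, r.length ≤ w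

/-- The count in the postcondition shows that a row moves from the remaining rows to the pivots
without changing their total number. -/
theorem findPivot_costs (w c : ℕ) (rows : List (List (ZMod p))) (h : RowsLE w rows) :
    (findPivot c rows : Party n p _).Costs 0 0 rows.length
      (fun t => ∀ r rest, t = some (r, rest) →
        r.length ≤ w ∧ RowsLE w rest ∧ rest.length + 1 = rows.length) := by
  induction rows with
  | nil => exact Costs.done (by simp)
  | cons r rs ih =>
      have hr : r.length ≤ w := h r (by simp)
      have hrs : RowsLE w rs := fun t ht => h t (by simp [ht])
      rw [findPivot]
      refine ((isEq_takes _ _).bind (r' := 0) (s' := 0) (o' := rs.length) fun b _ =>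
        Costs.ite (fun _ => ?_) (fun _ => ?_)).mono le_rfl le_rfl (by simp [add_comm])
      · refine (ih hrs).bind (r' := 0) (s' := 0) (o' := 0) fun t ht => ?_
        cases t with
        | none => exact Costs.pure (by simp)
        | some t =>
            obtain ⟨t, rest⟩ := t
            obtain ⟨h1, h2, h3⟩ := ht t rest rfl
            refine Costs.pure ?_
            rintro _ _ ⟨⟩
            exact ⟨h1, List.forall_mem_cons.2 ⟨hr, h2⟩, by simp [h3]⟩
      · refine (Costs.pure ?_).mono le_rfl le_rfl (Nat.zero_le _)
        rintro _ _ ⟨⟩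
        exact ⟨hr, hrs, rfl⟩

/-- Invariant: at most `H` rows in all, each of length at most `w`. A column costs at most `H` tests
for the pivot, one inversion, `w` multiplications to normalise, and `2 w` operations for each of at
most `H` rows to be cleared. -/
theorem eliminate_takes {H w : ℕ} (m c : ℕ) (piv : List (ℕ × List (ZMod p)))
    (rows : List (List (ZMod p))) (hpiv : ∀ t ∈ piv, t.2.length ≤ w) (hrows : RowsLE w rows)
    (hH : piv.length + rows.length ≤ H) :
    (eliminate m c piv rows : Party n p _).Takes 0 0 (m * (H + 1 + w + H * (w * 2))) := by
  induction m generalizing c piv rows with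
  | zero => exact (Costs.done trivial).mono le_rfl le_rfl (Nat.zero_le _)
  | succ m ih =>
      rw [eliminate]
      refine ((findPivot_costs w c rows hrows).bind (r' := 0) (s' := 0)
        (o' := 1 + w + H * (w * 2) + m * (H + 1 + w + H * (w * 2))) fun t ht => ?_).mono
          le_rfl le_rfl ?_
      · cases t with
        | none => exact (ih (c + 1) piv rows hpiv hrows hH).mono le_rfl le_rfl (by omega)
        | some t =>
            obtain ⟨r, rest⟩ := t
            obtain ⟨hr, hrest, hlen⟩ := ht r rest rfl
            refine ((inv_takes _).bind fun i _ =>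
              (Costs.mapM fun _ _ => mul_takes _ _).bind fun r' hr' =>
              (Costs.mapM (o := w * 2) (post := fun t : ℕ × List (ZMod p) => t.2.length ≤ w)
                fun t ht => ((subMul_costs _ _ _).bind fun u hu =>
                  Costs.pure (hu.trans_le (hpiv t ht))).mono le_rfl le_rfl
                    (by have := hpiv t ht; omega)).bind fun piv' hpiv' =>
              (Costs.mapM (o := w * 2) (post := fun u : List (ZMod p) => u.length ≤ w)
                fun t ht => ((subMul_costs _ _ _).imp fun u hu =>
                  hu.trans_le (hrest t ht)).mono le_rfl le_rfl
                    (by have := hrest t ht; omega)).bind fun rest' hrest' =>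
              ih (c + 1) _ rest' (List.forall_mem_cons.2 ⟨?_, hpiv'.2⟩) hrest'.2 ?_).mono
                le_rfl le_rfl ?_
            · exact hr'.1.trans_le hr
            · simp only [List.length_cons, hpiv'.1, hrest'.1]; omega
            · have : piv.length * (w * 2) + rest.length * (w * 2) ≤ H * (w * 2) := by
                rw [← add_mul]; gcongr; omega
              omega
      · rw [add_mul]; omega

theorem solve_costs {H w : ℕ} (m : ℕ) (rows : List (List (ZMod p))) (hrows : RowsLE w rows)
    (hH : rows.length ≤ H) :
    (solve m rows : Party n p _).Costs 0 0 (m * (H + 1 + w + H * (w * 2)))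
      (fun l => l.length = m) :=
  (eliminate_takes m 0 [] rows (by simp) hrows (by simpa)).bind fun _ _ =>
    (Costs.pure (by simp) : Costs _ 0 0 0 _)

theorem divide_costs (e : List (ZMod p)) (m : ℕ) (f : List (ZMod p)) :
    (divide e m f : Party n p _).Costs 0 0 (m * (f.length * 2)) (fun l => l.length ≤ m) := by
  induction m generalizing f with
  | zero => exact (Costs.done (by simp)).mono le_rfl le_rfl (Nat.zero_le _)
  | succ m ih =>
      cases f with
      | nil => exact (Costs.done (by simp)).mono le_rfl le_rfl (Nat.zero_le _)
      | cons a f =>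
          refine ((subMul_costs a f e).bind (o' := m * (f.length * 2)) fun f' hf' =>
            ((ih f').bind fun l hl => Costs.pure (by simpa using hl)).mono le_rfl le_rfl
              (by rw [hf']; rfl)).mono le_rfl le_rfl ?_
          simp only [List.length_cons]
          nlinarith

theorem lagrange_takes (pts : List (ZMod p × ZMod p)) (x : ZMod p) :
    (lagrange pts x : Party n p _).Takes 0 0 (pts.length * (pts.length * 6) + pts.length) :=
  -- Six operations per pair of points: one test, two subtractions, two multiplications, one
  -- inversion.
  ((Costs.mapM fun _ _ => Costs.foldlM (o := 6) (fun _ _ _ =>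
    (isEq_takes _ _).bind (o' := 5) fun _ _ => Costs.ite
      (fun _ => (Costs.pure trivial).mono le_rfl le_rfl (Nat.zero_le _))
      (fun _ => (sub_takes _ _).bind fun _ _ => (mul_takes _ _).bind fun _ _ =>
        (sub_takes _ _).bind fun _ _ => (inv_takes _).bind fun _ _ => mul_takes _ _)) _).bind
    (o' := pts.length) fun l hl => (sum_takes l).mono le_rfl le_rfl hl.1.le)

theorem berlekampWelch_costs {d N : ℕ} (pts : List (ZMod p × ZMod p)) (hN : pts.length = N)
    (hd : d ≤ N) :
    (berlekampWelch d pts : Party n p _).Costs 0 0 (20 * (N + 1) ^ 3) (fun l => l.length ≤ d + 1) := by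
  rw [berlekampWelch]
  -- This is all that matters about `e`: the system has `d + 2 e + 1 ≤ N + 1` unknowns and `N` rows,
  -- so elimination is cubic in `N`.
  have he : d + 2 * ((pts.length - d - 1) / 2) ≤ N := by omega
  generalize (pts.length - d - 1) / 2 = e at he
  refine ((Costs.mapM (o := 2 * N + 2) (post := fun r : List (ZMod p) => r.length ≤ 2 * N + 2)
    fun t _ => ((powers_costs _ _ _).bind fun u hu => (powers_costs _ _ _).bind fun v hv =>
      ((Costs.mapM fun _ _ => sub_takes _ _).mono (o' := e) le_rfl le_rfl (by simp)).bind
        fun v' hv' => Costs.pure ?_).mono le_rfl le_rfl ?_).bind fun rows hrows =>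
    (solve_costs (H := N) _ rows hrows.2 (hrows.1.trans hN).le).bind (o' := (d + 1) * ((d + e + 1) * 2))
      fun s hs => (divide_costs _ _ _).mono le_rfl le_rfl ?_).mono le_rfl le_rfl ?_
  · simp only [List.length_append, hu, hv'.1, List.length_take, List.length_singleton]; omega
  · omega
  · gcongr; simp
  · rw [hN]
    calc _ ≤ (N + 1) * (2 * (N + 1)) + ((N + 1) * ((N + 1) + 2 * (N + 1)
            + (N + 1) * (2 * (N + 1) * 2)) + (N + 1) * ((N + 1) * 2)) := by
          refine add_le_add (Nat.mul_le_mul (by omega) (by omega)) (add_le_add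
            (Nat.mul_le_mul (by omega) (add_le_add (by omega)
              (Nat.mul_le_mul (by omega) (by omega)))) (Nat.mul_le_mul (by omega) (by omega)))
      _ = 4 * (N + 1) ^ 2 + (3 * (N + 1) ^ 2 + 4 * (N + 1) ^ 3) := by ring
      _ ≤ 20 * (N + 1) ^ 3 := by nlinarith [Nat.zero_le (N * (N + 1) ^ 2)]

end Party

open Party

/-! ### Cost of reconstruction -/

/-- The operations of `reconst` in a quorum of `N` parties. -/
def reconstOps (N : ℕ) : ℕ := 100 * (N + 1) ^ 3

namespace Tools
variable {n N p : ℕ}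

/-- Cubic for two reasons: the consistency check makes `N` interpolations of quadratic cost, and
error correction solves one linear system. -/
theorem reconst_takes (Q : Fin N ↪ Fin n) (s : ZMod p) :
    (reconst Q s).Takes 1 N (reconstOps N) := by
  rw [reconst]
  refine (Costs.exchange.bind (r' := 0) (s' := 0) (o' := reconstOps N) fun got _ => ?_).mono
    le_rfl ?_ (by simp)
  · dsimp only
    generalize hp : List.ofFn (fun b : Fin N => ((point b : ZMod p), (got (Q b)).headD 0)) = pts
    have hpts : pts.length = N := by simp [← hp]
    have hlag : ∀ x, (lagrange (pts.take (N / 3 + 1)) x : Party n p _).Takes 0 0 (N * (N * 6) + N) :=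
      fun x => by
        have : (pts.take (N / 3 + 1)).length ≤ N := by simp [hpts]
        exact (lagrange_takes _ x).mono le_rfl le_rfl (by gcongr)
    refine ((Costs.mapM fun _ _ => (hlag _).bind fun _ _ => isEq_takes _ _).bind
      (r' := 0) (s' := 0) (o' := 20 * (N + 1) ^ 3 + 30 * (N + 1) ^ 2) fun _ _ =>
        Costs.ite (fun _ => ?_) (fun _ => ?_)).mono le_rfl le_rfl ?_
    · exact ((hlag 0).bind fun _ _ => Costs.pure trivial).mono le_rfl le_rfl (by nlinarith)
    · refine ((berlekampWelch_costs pts hpts (by omega)).bind fun φ hφ =>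
        ((horner_takes _ _).mono (o' := (N + 1) * 2) le_rfl le_rfl (by omega)).bind fun _ _ =>
        (Costs.mapM (o := (N + 1) * 2 + 1) (post := fun _ => True) fun _ _ => ((horner_takes _ _).bind fun _ _ =>
          isEq_takes _ _).mono le_rfl le_rfl (by omega)).bind fun _ _ =>
            Costs.pure trivial).mono le_rfl le_rfl ?_
      rw [hpts]
      nlinarith
    · rw [hpts, reconstOps]
      have : 0 ≤ N ^ 3 := Nat.zero_le _
      nlinarith
  · simp only [apply_ite List.length, List.length_singleton, List.length_nil, Finset.sum_ite_mem]
    simp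

end Tools

/-! ### Continuations after an exchange -/

namespace Party
variable {n p : ℕ} {α : Type}

/-- The worst case of an exchange ranges over all inboxes, including the one that carries exactly
`got`. Thus a bound for the program with a physical channel also bounds its continuation on whatever
the broadcast protocol returns. -/
theorem rounds_le_exchange_bind (out : Fin n → List (ZMod p))
    (k : (Fin n → List (ZMod p)) → Party n p α) (got : Fin n → List (ZMod p)) :
    (k got).rounds ≤ (exchange out >>= k).rounds :=
  (le_iSup (fun z : Fin n → Msg p => (k fun j => (z j).list).rounds)
    (fun j => .elems (got j))).trans le_add_self

theorem sent_le_exchange_bind (out : Fin n → List (ZMod p))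
    (k : (Fin n → List (ZMod p)) → Party n p α) (got : Fin n → List (ZMod p)) :
    (k got).sent ≤ (exchange out >>= k).sent :=
  (le_iSup (fun z : Fin n → Msg p => (k fun j => (z j).list).sent)
    (fun j => .elems (got j))).trans le_add_self

theorem ops_le_exchange_bind (out : Fin n → List (ZMod p))
    (k : (Fin n → List (ZMod p)) → Party n p α) (got : Fin n → List (ZMod p)) :
    (k got).ops ≤ (exchange out >>= k).ops :=
  le_iSup (fun z : Fin n → Msg p => (k fun j => (z j).list).ops) (fun j => .elems (got j))

end Party

/-! ### Bounds for the subprotocols of the shuffle -/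

/-- Cost of one round of broadcast in the secret sharing scheme. -/
def broadcastRoundCost (κ N : ℕ) : ℕ := (N + 1) * (κ * ((N + 2) * (κ * (N + 1) ^ κ + 1)) ^ κ)

/-- Cost of sharing a value. -/
def shareCost (κ N : ℕ) : ℕ := broadcastRoundCost κ N + κ * (N + 1) ^ κ

/-- Cost of generating a random shared value or renewing a sharing. -/
def genRandCost (κ N : ℕ) : ℕ := N * shareCost κ N + N + 3

/-- Cost of a multiplication. -/
def multiplyCost (κ N : ℕ) : ℕ := 5 * genRandCost κ N + 2 * reconstOps N + 2 * N + 9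

/-- Rounds of a multiplication. -/
def multiplyRounds (κ : ℕ) : ℕ := 2 * (κ + 3) + 1

/-- Cost of a gate, where `b` is the length of a field element. -/
def gateCost (κ N b : ℕ) : ℕ :=
  κ * b * multiplyCost κ N + 2 * (κ * b ^ κ) + 8 * multiplyCost κ N + 4 * genRandCost κ N + 5

/-- Rounds of a gate. -/
def gateRounds (κ : ℕ) : ℕ := κ * multiplyRounds κ + multiplyRounds κ + (κ + 3)

theorem le_reconstOps (N : ℕ) : N ≤ reconstOps N := by
  rw [reconstOps]; nlinarith [Nat.zero_le (N ^ 3)]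

theorem card_members_le {n N : ℕ} (Q : Fin N ↪ Fin n) (dealer : Fin n) :
    (members Q dealer).card ≤ N + 1 :=
  (Finset.card_insert_le _ _).trans (by simp)

namespace Tools
variable {n N p κ : ℕ} {T : Tools n N p}

/-- Of the `n` parallel sessions only the at most `N + 1` with a sender in `S` do anything, which
makes the cost independent of `n`. -/
theorem broadcastRound_takes (hT : T.WithinCosts κ) {S : Finset (Fin n)} (hS : S.card ≤ N + 1)
    (me : Fin n) (m : List (ZMod p)) :
    (T.broadcastRound S T.vssLen me m).Takes κ (broadcastRoundCost κ N)
      (broadcastRoundCost κ N) := by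
  have hle : κ * ((S.card + 1) * (T.vssLen + 1)) ^ κ ≤
      κ * ((N + 2) * (κ * (N + 1) ^ κ + 1)) ^ κ := by
    have := hT.vss_len
    refine Nat.mul_le_mul le_rfl (Nat.pow_le_pow_left (Nat.mul_le_mul ?_ ?_) _) <;> omega
  have key : ∀ (me : Fin n) (m : List (ZMod p)), (parAll n (fun sender =>
      if sender ∈ S ∧ me ∈ S then
        T.broadcast S T.vssLen sender me (if sender = me then m.take T.vssLen else [])
      else Party.done [])).Takes κ (broadcastRoundCost κ N) (broadcastRoundCost κ N) := by
    intro me m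
    have hsum : ∑ sender : Fin n, (if sender ∈ S then
        κ * ((N + 2) * (κ * (N + 1) ^ κ + 1)) ^ κ else 0) ≤ broadcastRoundCost κ N := by
      rw [Finset.sum_ite_mem]
      simp only [Finset.univ_inter, Finset.sum_const, smul_eq_mul]
      exact Nat.mul_le_mul_right _ hS
    refine (Costs.parAll (post := fun _ => True) fun sender => ?_).mono le_rfl hsum hsum
    split_ifs with h h1 h1 h1
    · have hm : (List.take T.vssLen m).length ≤ T.vssLen := by simp
      exact ⟨hT.broadcast_rounds _ _ _ h.1 _ h.2 _ hm,
        (hT.broadcast_sent _ _ _ h.1 _ h.2 _ hm).trans (by exact_mod_cast hle),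
        (hT.broadcast_ops _ _ _ h.1 _ h.2 _ hm).trans (by exact_mod_cast hle), returns_true _⟩
    · exact absurd h.1 h1
    · have hm : ([] : List (ZMod p)).length ≤ T.vssLen := by simp
      exact ⟨hT.broadcast_rounds _ _ _ h.1 _ h.2 _ hm,
        (hT.broadcast_sent _ _ _ h.1 _ h.2 _ hm).trans (by exact_mod_cast hle),
        (hT.broadcast_ops _ _ _ h.1 _ h.2 _ hm).trans (by exact_mod_cast hle), returns_true _⟩
    · exact absurd h.1 (by assumption)
    · exact (Costs.done trivial).mono (Nat.zero_le _) (Nat.zero_le _) (Nat.zero_le _)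
    · exact (Costs.done trivial).mono (Nat.zero_le _) (Nat.zero_le _) (Nat.zero_le _)
  exact Costs.lockstep (fun i y => (key i y).rounds_le) (key me m)

/-- Replacing the exchange in `vssOnChannel` by the broadcast protocol adds at most the cost of one
`broadcastRound` on each branch. The replaced round is still counted, hence `κ + 3`. -/
theorem share_takes (hT : T.WithinCosts κ) (Q : Fin N ↪ Fin n) {deg : ℕ} (hdeg : deg ≤ N)
    (dealer me : Fin n) (secret : ZMod p) :
    (T.share Q deg dealer me secret).Takes (κ + 3)
      (if me ∈ members Q dealer then shareCost κ N else 0)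
      (if me ∈ members Q dealer then shareCost κ N else 0) := by
  have key : ∀ (me : Fin n) (secret : ZMod p), (if me ∈ members Q dealer then do
      let (m, k) ← T.vss Q deg dealer me secret
      let got ← T.broadcastRound (members Q dealer) T.vssLen me m
      k got
    else Party.done 0).Takes (κ + 3)
      (if me ∈ members Q dealer then shareCost κ N else 0)
      (if me ∈ members Q dealer then shareCost κ N else 0) := by
    intro me secret
    split_ifs with h
    · have hb := fun m => broadcastRound_takes hT (card_members_le Q dealer) me m
      refine ⟨(rounds_bind_le_add (c := κ) fun mk => ?_).trans
          ((add_le_add le_rfl (hT.vss_rounds Q deg dealer me h secret)).trans (by push_cast; rfl)),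
        (sent_bind_le_add (c := broadcastRoundCost κ N) fun mk => ?_).trans
          ((add_le_add le_rfl (hT.vss_sent Q deg dealer me h secret hdeg)).trans
            (by rw [shareCost]; push_cast; rfl)),
        (ops_bind_le_add (c := broadcastRoundCost κ N) fun mk => ?_).trans
          ((add_le_add le_rfl (hT.vss_ops Q deg dealer me h secret hdeg)).trans
            (by rw [shareCost]; push_cast; rfl)), returns_true _⟩
      · exact (rounds_bind_le (returns_true _) fun got _ => rounds_le_exchange_bind _ mk.2 got).trans
          (add_le_add (hb _).rounds_le le_rfl)
      · exact (sent_bind_le (returns_true _) fun got _ => sent_le_exchange_bind _ mk.2 got).trans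
          (add_le_add (hb _).sent_le le_rfl)
      · exact (ops_bind_le (returns_true _) fun got _ => ops_le_exchange_bind _ mk.2 got).trans
          (add_le_add (hb _).ops_le le_rfl)
    · exact (Costs.done trivial).mono (Nat.zero_le _) (Nat.zero_le _) (Nat.zero_le _)
  exact Costs.lockstep (fun i y => (key i y).rounds_le) (key me secret)

/-- Two operations below `genRandCost`: that slack pays for the multiplication and the addition in
`renewShares`. -/
theorem genRand_costs (hT : T.WithinCosts κ) (Q : Fin N ↪ Fin n) {deg : ℕ} (hdeg : deg ≤ N)
    (a : Fin N) :
    (T.genRand Q deg a).Takes (κ + 3) (N * shareCost κ N) (N * shareCost κ N + N + 1) :=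
  (Costs.random.bind fun ρ _ => (Costs.parAll_const fun b =>
    (share_takes hT Q hdeg (Q b) (Q a) (if b = a then ρ else 0)).mono le_rfl
      (s' := shareCost κ N) (o' := shareCost κ N) (by split_ifs <;> simp)
      (by split_ifs <;> simp)).bind fun got _ =>
    (sum_takes (List.ofFn got)).mono (o' := N) le_rfl le_rfl (by simp)).mono
    (by omega) (by omega) (by omega)

theorem genRand_takes (hT : T.WithinCosts κ) (Q : Fin N ↪ Fin n) {deg : ℕ} (hdeg : deg ≤ N)
    (a : Fin N) : (T.genRand Q deg a).Takes (κ + 3) (genRandCost κ N) (genRandCost κ N) :=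
  (genRand_costs hT Q hdeg a).mono le_rfl (by rw [genRandCost]; omega) (by rw [genRandCost]; omega)

theorem renewShares_takes (hT : T.WithinCosts κ) (Q : Fin N ↪ Fin n) (a : Fin N) (s : ZMod p) :
    (T.renewShares Q a s).Takes (κ + 3) (genRandCost κ N) (genRandCost κ N) :=
  ((genRand_costs hT Q (by omega) a).bind fun _ _ => (mul_takes _ _).bind fun _ _ =>
    add_takes _ _).mono le_rfl (by rw [genRandCost]; omega) (by rw [genRandCost])

/-- Three parallel phases: two generations, three renewals, two reconstructions. The `9` in
`multiplyCost` counts the field operations between and after them. -/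
theorem multiply_takes (hT : T.WithinCosts κ) (Q : Fin N ↪ Fin n) (a : Fin N) (x y : ZMod p) :
    (T.multiply Q a x y).Takes (multiplyRounds κ) (multiplyCost κ N) (multiplyCost κ N) := by
  have hg := genRand_takes hT Q (Nat.div_le_self N 6) a
  have hr := renewShares_takes hT Q a
  rw [multiply]
  refine ((hg.par hg).bind (r' := κ + 3 + 1) (s' := 3 * genRandCost κ N + 2 * N)
    (o' := 3 * genRandCost κ N + 2 * reconstOps N + 9) fun ⟨u, v⟩ _ => ?_).mono
    (by rw [multiplyRounds]; omega) (by rw [multiplyCost]; omega) (by rw [multiplyCost]; omega)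
  refine ((mul_takes u v).bind fun w _ => ((hr u).par ((hr v).par (hr w))).bind (r' := 1)
    (s' := 2 * N) (o' := 2 * reconstOps N + 8) fun ⟨u, v, w⟩ _ => ?_).mono
    (by omega) (by omega) (by omega)
  refine ((add_takes x u).bind fun _ _ => (add_takes y v).bind fun _ _ =>
    ((reconst_takes Q _).par (reconst_takes Q _)).bind (r' := 0) (s' := 0) (o' := 6)
      fun ⟨εr, δr⟩ _ => ?_).mono (by omega) (by omega) (by omega)
  exact (affine_takes _ [_, _]).bind fun _ _ => (mul_takes _ _).bind fun _ _ => sub_takes _ _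

theorem le_iSup_three {α β γ : Type} (f : α → β → γ → ℕ∞) (a : α) (b : β) (c : γ) :
    f a b c ≤ ⨆ a, ⨆ b, ⨆ c, f a b c :=
  le_iSup_of_le a (le_iSup_of_le b (le_iSup (f a b) c))

/-- Generation and opening are each no dearer than a multiplication, so every invocation is charged
as one. -/
theorem secure_takes (hT : T.WithinCosts κ) (Q : Fin N ↪ Fin n) (a : Fin N) {m o : ℕ}
    (factors : Fin m → ZMod p × ZMod p) (r : ℕ) (opened : Fin o → ZMod p) :
    (par (parAll m (fun i => T.multiply Q a (factors i).1 (factors i).2))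
      (par (parAll r (fun _ => T.genRand Q (N / 3) a))
        (parAll o (fun i => reconst Q (opened i))))).Takes (multiplyRounds κ)
      ((m + r + o) * multiplyCost κ N) ((m + r + o) * multiplyCost κ N) := by
  have h1 : genRandCost κ N ≤ multiplyCost κ N := by rw [multiplyCost]; omega
  have h2 : reconstOps N ≤ multiplyCost κ N := by rw [multiplyCost]; omega
  refine ((Costs.parAll_const fun _ => multiply_takes hT Q a _ _).par
    ((Costs.parAll_const fun _ => (genRand_takes hT Q (by omega) a).mono
      (by rw [multiplyRounds]; omega) h1 h1).par
    (Costs.parAll_const fun _ => (reconst_takes Q _).mono (by rw [multiplyRounds]; omega)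
      ((le_reconstOps N).trans h2) h2))).mono le_rfl ?_ ?_ <;>
  rw [add_mul, add_mul, add_assoc]

theorem exec_rounds_le (hT : T.WithinCosts κ) (Q : Fin N ↪ Fin n) (a : Fin N)
    (P : Script p (ZMod p)) : (T.exec Q a P).rounds ≤ P.depth * (multiplyRounds κ : ℕ) := by
  induction P with
  | ret s => simp [exec, rounds, Script.depth]
  | op o x y k ih => exact ih _
  | affine c l k ih =>
      refine (rounds_bind_le (returns_true _) fun s _ => (ih s).trans
        (mul_le_mul_left (le_iSup (fun s => (k s).depth) s) _)).trans ?_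
      refine (add_le_add (affine_takes c l).rounds_le le_rfl).trans ?_
      simp [Script.depth]
  | secure m factors r o opened k ih =>
      refine (rounds_bind_le (returns_true _) fun ⟨u, v, w⟩ _ => (ih u v fun i => (w i).1).trans
        (mul_le_mul_left (le_iSup_three (fun u v w => (k u v w).depth)
          u v fun i => (w i).1) _)).trans ?_
      refine (add_le_add (secure_takes hT Q a factors r opened).rounds_le le_rfl).trans ?_
      simp [Script.depth, add_mul]

theorem exec_sent_le (hT : T.WithinCosts κ) (Q : Fin N ↪ Fin n) (a : Fin N)
    (P : Script p (ZMod p)) : (T.exec Q a P).sent ≤ P.invocations * (multiplyCost κ N : ℕ) := by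
  induction P with
  | ret s => simp [exec, sent, Script.invocations]
  | op o x y k ih => exact ih _
  | affine c l k ih =>
      refine (sent_bind_le (returns_true _) fun s _ => (ih s).trans
        (mul_le_mul_left (le_iSup (fun s => (k s).invocations) s) _)).trans ?_
      refine (add_le_add (affine_takes c l).sent_le le_rfl).trans ?_
      simp [Script.invocations]
  | secure m factors r o opened k ih =>
      refine (sent_bind_le (returns_true _) fun ⟨u, v, w⟩ _ => (ih u v fun i => (w i).1).trans
        (mul_le_mul_left (le_iSup_three (fun u v w => (k u v w).invocations)
          u v fun i => (w i).1) _)).trans ?_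
      refine (add_le_add (secure_takes hT Q a factors r opened).sent_le le_rfl).trans ?_
      simp [Script.invocations, add_mul]

/-- The factor `2` arises because an affine combination counts `l.length + 1` in `localOps` but
takes a multiplication and an addition per term. -/
theorem exec_ops_le (hT : T.WithinCosts κ) (Q : Fin N ↪ Fin n) (a : Fin N)
    (P : Script p (ZMod p)) :
    (T.exec Q a P).ops ≤ P.invocations * (multiplyCost κ N : ℕ) + 2 * P.localOps := by
  induction P with
  | ret s => simp [exec, ops, Script.invocations]
  | op o x y k ih =>
      refine (add_le_add le_rfl (ih _)).trans ?_
      simp only [Script.invocations, Script.localOps, mul_add]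
      rw [add_left_comm]
      gcongr
      norm_num
  | affine c l k ih =>
      refine (ops_bind_le (returns_true _) fun s _ => (ih s).trans
        (add_le_add (mul_le_mul_left (le_iSup (fun s => (k s).invocations) s) _)
          (mul_le_mul_right (le_iSup (fun s => (k s).localOps) s) _))).trans ?_
      refine (add_le_add (affine_takes c l).ops_le le_rfl).trans ?_
      simp only [Script.invocations, Script.localOps, mul_add]
      rw [add_left_comm]
      gcongr
      norm_cast
      omega
  | secure m factors r o opened k ih =>
      refine (ops_bind_le (returns_true _) fun ⟨u, v, w⟩ _ => (ih u v fun i => (w i).1).trans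
        (add_le_add (mul_le_mul_left (le_iSup_three (fun u v w => (k u v w).invocations)
          u v fun i => (w i).1) _)
          (mul_le_mul_right (le_iSup_three (fun u v w => (k u v w).localOps)
          u v fun i => (w i).1) _))).trans ?_
      refine (add_le_add (secure_takes hT Q a factors r opened).ops_le le_rfl).trans ?_
      simp [Script.invocations, Script.localOps, add_mul, add_assoc]

theorem compare_takes (hT : T.WithinCosts κ) (Q : Fin N ↪ Fin n) (a : Fin N) (r r' : ZMod p) :
    (T.exec Q a (T.compare _ r r')).Takes (κ * multiplyRounds κ)
      (κ * Nat.clog 2 p * multiplyCost κ N)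
      (κ * Nat.clog 2 p * multiplyCost κ N + 2 * (κ * Nat.clog 2 p ^ κ)) where
  rounds_le := (exec_rounds_le hT Q a _).trans (by
    push_cast; gcongr; exact hT.compare_depth r r')
  sent_le := (exec_sent_le hT Q a _).trans (by
    rw [Nat.cast_mul]; gcongr; exact hT.compare_invocations r r')
  ops_le := (exec_ops_le hT Q a _).trans (by
    rw [Nat.cast_add, Nat.cast_mul, Nat.cast_mul 2]
    gcongr
    · exact hT.compare_invocations r r'
    · exact le_rfl
    · exact hT.compare_localOps r r')
  returns := returns_true _

theorem gate_takes (hT : T.WithinCosts κ) (Q : Fin N ↪ Fin n) (a : Fin N)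
    (i i' : ZMod p × ZMod p) :
    (T.gate Q a i i').Takes (gateRounds κ) (gateCost κ N (Nat.clog 2 p))
      (gateCost κ N (Nat.clog 2 p)) :=
  ((compare_takes hT Q a _ _).bind fun _ _ => (sub_takes _ _).bind fun _ _ =>
    (Costs.parAll_const fun _ => multiply_takes hT Q a _ _).bind fun _ _ =>
    (add_takes _ _).bind fun _ _ => (add_takes _ _).bind fun _ _ =>
    (add_takes _ _).bind fun _ _ => (add_takes _ _).bind fun _ _ =>
    (Costs.parAll_const fun _ => renewShares_takes hT Q a _).bind fun _ _ =>
      Costs.pure trivial).mono (by rw [gateRounds]; omega) (by rw [gateCost]; omega)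
    (by rw [gateCost]; omega)

end Tools

open Network

/-! ### Total costs -/

/-- Work of the party `me` for a task that costs each member of `Q` at most `c`. -/
def memberCost {n N : ℕ} (Q : Fin N ↪ Fin n) (me : Fin n) (c : ℕ) : ℕ :=
  if me ∈ Finset.univ.map Q then c else 0

/-- The double counting behind all totals: a quorum has exactly `N` distinct members, so a task is
paid for `N` times however its quorum overlaps the others. -/
theorem sum_memberCost {n N : ℕ} (Q : Fin N ↪ Fin n) (c : ℕ) :
    ∑ me, memberCost Q me c = N * c := by
  simp only [memberCost, Finset.sum_ite_mem, Finset.univ_inter, Finset.sum_const, smul_eq_mul,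
    Finset.card_map, Finset.card_univ, Fintype.card_fin]

theorem memberCost_add {n N : ℕ} (Q : Fin N ↪ Fin n) (me : Fin n) (c d : ℕ) :
    memberCost Q me (c + d) = memberCost Q me c + memberCost Q me d := by
  unfold memberCost; split_ifs <;> rfl

theorem memberCost_of_mem {n N : ℕ} {Q : Fin N ↪ Fin n} {me : Fin n} (h : ∃ a, Q a = me) (c : ℕ) :
    memberCost Q me c = c :=
  if_pos (by simpa using h)

theorem memberCost_zero {n N : ℕ} (Q : Fin N ↪ Fin n) (me : Fin n) : memberCost Q me 0 = 0 :=
  ite_self _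

/-- The comparators of a level occupy pairwise distinct wires, two each. -/
theorem Network.length_le {n : ℕ} (G : Network n) {L : List (Fin n × Fin n)} (hL : L ∈ G.levels) :
    L.length ≤ n := by
  have := (G.disjoint L hL).length_le_card
  simp only [List.length_append, List.length_map, Fintype.card_fin] at this
  omega

namespace Tools
variable {n N p κ : ℕ}

theorem asMember_takes {α : Type} {Q : Fin N ↪ Fin n} {me : Fin n} {dflt : α}
    {f : Fin N → Party n p α} {r s o : ℕ} (h : ∀ a, (f a).Takes r s o) :
    (asMember Q me dflt f).Takes r (memberCost Q me s) (memberCost Q me o) := by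
  unfold asMember
  split_ifs with hm
  · rw [memberCost_of_mem hm, memberCost_of_mem hm]; exact h _
  · exact (Costs.done trivial).mono (Nat.zero_le _) (Nat.zero_le _) (Nat.zero_le _)

theorem forward_takes (Q Q' : Fin N ↪ Fin n) (me : Fin n) (v : ZMod p × ZMod p) :
    (forward Q Q' me v).Takes 1 (memberCost Q me 2) 0 := by
  refine (Costs.exchange.bind fun got _ => asMember_takes fun a => Costs.done trivial).mono
    le_rfl ?_ (by simp [memberCost_zero])
  rw [memberCost_zero, add_zero]
  by_cases h : ∃ a, Q a = me
  · rw [memberCost_of_mem h]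
    obtain ⟨a, rfl⟩ := h
    -- `Q` is injective, so the sender has only one index `a` and the pair goes to `Q' a` alone.
    refine (Finset.sum_le_sum (g := fun j => if Q' a = j then 2 else 0) fun j _ => ?_).trans
      (by simp)
    by_cases hj : Q' a = j <;> simp [hj]
  · rw [Finset.sum_eq_zero]
    · exact Nat.zero_le _
    · rintro j -
      rw [if_neg fun ⟨a, ha, _⟩ => h ⟨a, ha⟩]
      rfl

variable [NeZero n] {T : Tools n N p}

/-- Work of the party `me` for input sharing and random generation. -/
def inputsLoad (κ : ℕ) (Q : Fin n → (Fin N ↪ Fin n)) (G : Network n) (me : Fin n) : ℕ :=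
  ∑ w, (if me ∈ members (quorumOf Q (G.inputGate w)) w then shareCost κ N else 0) +
    ∑ w, memberCost (quorumOf Q (G.inputGate w)) me (genRandCost κ N)

/-- After exchanging the sums, each wire involves its quorum and at most one further party, the
dealer. -/
theorem sum_inputsLoad_le (κ : ℕ) (Q : Fin n → (Fin N ↪ Fin n)) (G : Network n) :
    ∑ me, inputsLoad κ Q G me ≤ n * ((N + 1) * shareCost κ N + N * genRandCost κ N) := by
  simp only [inputsLoad, Finset.sum_add_distrib, mul_add]
  rw [Finset.sum_comm, Finset.sum_comm (f := fun me w => memberCost _ me _)]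
  refine add_le_add ?_ ?_
  · refine (Finset.sum_le_card_nsmul _ _ ((N + 1) * shareCost κ N) fun w _ => ?_).trans (by simp)
    rw [Finset.sum_ite_mem, Finset.univ_inter, Finset.sum_const, smul_eq_mul]
    exact Nat.mul_le_mul_right _ (card_members_le _ _)
  · simp [sum_memberCost]

theorem inputs_takes (hT : T.WithinCosts κ) (Q : Fin n → (Fin N ↪ Fin n)) (G : Network n)
    (x : Fin n → ZMod p) (me : Fin n) :
    (T.inputs Q G x me).Takes (2 * (κ + 3)) (inputsLoad κ Q G me) (inputsLoad κ Q G me) := by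
  have h1 := fun me : Fin n => Costs.parAll fun w : Fin n =>
    share_takes hT (quorumOf Q (G.inputGate w)) (Nat.div_le_self N 3) w me (if w = me then x w else 0)
  have h2 := fun me : Fin n => Costs.parAll fun w : Fin n =>
    asMember_takes (Q := quorumOf Q (G.inputGate w)) (me := me) (dflt := 0)
      fun a => genRand_takes hT (quorumOf Q (G.inputGate w)) (Nat.div_le_self N 3) a
  exact ((Costs.lockstep (fun i _ => (h1 i).rounds_le) (h1 me)).bind fun _ _ =>
    (Costs.lockstep (fun i _ => (h2 i).rounds_le) (h2 me)).bind fun _ _ =>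
      Costs.pure trivial).mono (by omega) le_rfl le_rfl

/-- Work of the party `me` for a level whose gates are numbered from `i` on. -/
def levelLoad (c : ℕ) (Q : Fin n → (Fin N ↪ Fin n)) (i : ℕ) (L : List (Fin n × Fin n))
    (me : Fin n) : ℕ :=
  ∑ j : Fin L.length, memberCost (quorumOf Q (i + j)) me (c + 4)

theorem sum_levelLoad (c : ℕ) (Q : Fin n → (Fin N ↪ Fin n)) (i : ℕ) (L : List (Fin n × Fin n)) :
    ∑ me, levelLoad c Q i L me = L.length * (N * (c + 4)) := by
  simp only [levelLoad]
  rw [Finset.sum_comm]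
  simp [sum_memberCost]

/-- The extra round is the forwarding, and the `4` in `levelLoad` its traffic: two pairs of shares
per member. -/
theorem level_takes (hT : T.WithinCosts κ) (Q : Fin n → (Fin N ↪ Fin n)) (i : ℕ)
    (L : List (Fin n × Fin n)) (Ls : List (List (Fin n × Fin n))) (me : Fin n) (st : Shares n p) :
    (T.level Q i L Ls me st).Takes (gateRounds κ + 1)
      (levelLoad (gateCost κ N (Nat.clog 2 p)) Q i L me)
      (levelLoad (gateCost κ N (Nat.clog 2 p)) Q i L me) := by
  have h1 := fun (me : Fin n) (st : Shares n p) => Costs.parAll fun j : Fin L.length =>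
    asMember_takes (Q := quorumOf Q (i + j)) (me := me) (dflt := ((0, 0), (0, 0)))
      fun a => gate_takes hT (quorumOf Q (i + j)) a (st (L.get j).1) (st (L.get j).2)
  refine ((Costs.lockstep (fun i st => (h1 i st).rounds_le) (h1 me st)).bind fun out _ =>
    (Costs.parAll fun j => (forward_takes (quorumOf Q (i + j)) _ me _).par
      (forward_takes (quorumOf Q (i + j)) _ me _)).bind fun _ _ =>
        Costs.pure trivial).mono le_rfl ?_ ?_
  · simp only [levelLoad, add_zero, ← Finset.sum_add_distrib, ← memberCost_add]
    rfl
  · simp only [levelLoad, add_zero, Finset.sum_const_zero, memberCost_add, Finset.sum_add_distrib]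
    exact Nat.le_add_right _ _

/-- Work of the party `me` for the given levels, whose gates are numbered from `i` on. -/
def circuitLoad (c : ℕ) (Q : Fin n → (Fin N ↪ Fin n)) (me : Fin n) :
    ℕ → List (List (Fin n × Fin n)) → ℕ
  | _, [] => 0
  | i, L :: Ls => levelLoad c Q i L me + circuitLoad c Q me (i + L.length) Ls

theorem sum_circuitLoad_le (c : ℕ) (Q : Fin n → (Fin N ↪ Fin n)) (i : ℕ)
    (Ls : List (List (Fin n × Fin n))) (h : ∀ L ∈ Ls, L.length ≤ n) :
    ∑ me, circuitLoad c Q me i Ls ≤ n * (Ls.length * (N * (c + 4))) := by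
  induction Ls generalizing i with
  | nil => simp [circuitLoad]
  | cons L Ls ih =>
      simp only [circuitLoad, Finset.sum_add_distrib, sum_levelLoad, List.length_cons]
      have h1 : L.length * (N * (c + 4)) ≤ n * (N * (c + 4)) :=
        Nat.mul_le_mul_right _ (h L (by simp))
      have h2 := ih (i + L.length) fun L' hL' => h L' (by simp [hL'])
      calc _ ≤ n * (N * (c + 4)) + n * (Ls.length * (N * (c + 4))) := add_le_add h1 h2
        _ = _ := by ring

theorem circuit_takes (hT : T.WithinCosts κ) (Q : Fin n → (Fin N ↪ Fin n)) (me : Fin n) (i : ℕ)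
    (Ls : List (List (Fin n × Fin n))) (st : Shares n p) :
    (T.circuit Q me i Ls st).Takes (Ls.length * (gateRounds κ + 1))
      (circuitLoad (gateCost κ N (Nat.clog 2 p)) Q me i Ls)
      (circuitLoad (gateCost κ N (Nat.clog 2 p)) Q me i Ls) := by
  induction Ls generalizing i st with
  | nil => exact (Costs.done trivial).mono (Nat.zero_le _) le_rfl le_rfl
  | cons L Ls ih =>
      exact ((level_takes hT Q i L Ls me st).bind fun st' _ => ih (i + L.length) st').mono
        (by rw [List.length_cons, add_mul]; omega) le_rfl le_rfl

/-- Work of the party `me` for the shuffle. -/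
def shuffleLoad (κ p : ℕ) (Q : Fin n → (Fin N ↪ Fin n)) (G : Network n) (me : Fin n) : ℕ :=
  inputsLoad κ Q G me + circuitLoad (gateCost κ N (Nat.clog 2 p)) Q me 0 G.levels

theorem shuffle_takes (hT : T.WithinCosts κ) (Q : Fin n → (Fin N ↪ Fin n)) (G : Network n)
    (x : Fin n → ZMod p) (me : Fin n) :
    (T.shuffle Q G x me).Takes (2 * (κ + 3) + G.depth * (gateRounds κ + 1))
      (shuffleLoad κ p Q G me) (shuffleLoad κ p Q G me) :=
  (inputs_takes hT Q G x me).bind fun st _ => circuit_takes hT Q me 0 G.levels st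

/-- Work for the shuffle per wire of a network of depth `d`, with quorums of `N` parties and field
elements of `b` bits. -/
def wireLoad (κ N b d : ℕ) : ℕ :=
  (N + 1) * shareCost κ N + N * genRandCost κ N + d * (N * (gateCost κ N b + 4))

theorem sum_shuffleLoad_le (κ p : ℕ) (Q : Fin n → (Fin N ↪ Fin n)) (G : Network n) :
    ∑ me, shuffleLoad κ p Q G me ≤ n * wireLoad κ N (Nat.clog 2 p) G.depth := by
  simp only [shuffleLoad, Finset.sum_add_distrib, wireLoad, mul_add n]
  have h1 := sum_inputsLoad_le κ Q G
  have h2 := sum_circuitLoad_le (gateCost κ N (Nat.clog 2 p)) Q 0 G.levels fun L hL =>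
    G.length_le hL
  rw [mul_add] at h1
  exact add_le_add h1 h2

/-- Field elements that the party `me` sends for output propagation. -/
def outputLoad (Q : Fin n → (Fin N ↪ Fin n)) (G : Network n) (me : Fin n) : ℕ :=
  ∑ w, memberCost (quorumOf Q (G.outputGate w)) me (N + n)

theorem sum_outputLoad (Q : Fin n → (Fin N ↪ Fin n)) (G : Network n) :
    ∑ me, outputLoad Q G me = n * (N * (N + n)) := by
  simp only [outputLoad]
  rw [Finset.sum_comm]
  simp [sum_memberCost]

/-- The operations of output propagation enter none of the totals, so any finite bound for them will
do. -/
theorem output_takes (Q : Fin n → (Fin N ↪ Fin n)) (G : Network n) (me : Fin n)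
    (st : Shares n p) :
    ∃ o, (output Q G me st).Takes 2 (outputLoad Q G me) o := by
  have h1 := fun (me : Fin n) (st : Shares n p) => Costs.parAll fun w : Fin n =>
    asMember_takes (Q := quorumOf Q (G.outputGate w)) (me := me) (dflt := (0, []))
      fun _ => reconst_takes (quorumOf Q (G.outputGate w)) (st w).2
  refine ⟨_, ((Costs.lockstep (fun i st => (h1 i st).rounds_le) (h1 me st)).bind fun z _ =>
    Costs.parAll fun w => ((Costs.exchange.mono le_rfl
      (s' := memberCost (quorumOf Q (G.outputGate w)) me n) ?_ le_rfl).bind fun got _ =>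
        (majority_takes _).mono (o' := N * N) le_rfl le_rfl ?_)).mono le_rfl ?_ le_rfl⟩
  · by_cases h : ∃ a, quorumOf Q (G.outputGate w) a = me
    · rw [memberCost_of_mem h]; simp [h]
    · simp [h]
  · simp
  · simp only [outputLoad, add_zero, memberCost_add, Finset.sum_add_distrib]
    rfl

theorem totalBits_le (hT : T.WithinCosts κ) (Q : Fin n → (Fin N ↪ Fin n)) (G : Network n)
    (x : Fin n → ZMod p) :
    T.totalBits Q G x ≤ ((κ * n * Nat.log 2 n ^ κ +
      Nat.clog 2 p * (n * wireLoad κ N (Nat.clog 2 p) G.depth) : ℕ) : ℕ∞) := by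
  rw [totalBits, Finset.sum_add_distrib, Nat.cast_add]
  refine add_le_add hT.quorums_bits ?_
  calc ∑ i, (T.shuffle Q G x i).bits
      ≤ ∑ i, ((Nat.clog 2 p * shuffleLoad κ p Q G i : ℕ) : ℕ∞) := Finset.sum_le_sum fun i _ => by
        rw [bits, Nat.cast_mul]; gcongr; exact (shuffle_takes hT Q G x i).sent_le
    _ = ((Nat.clog 2 p * ∑ i, shuffleLoad κ p Q G i : ℕ) : ℕ∞) := by
        rw [Finset.mul_sum, Nat.cast_sum]
    _ ≤ _ := by exact_mod_cast Nat.mul_le_mul_left _ (sum_shuffleLoad_le κ p Q G)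

theorem totalOps_le (hT : T.WithinCosts κ) (Q : Fin n → (Fin N ↪ Fin n)) (G : Network n)
    (x : Fin n → ZMod p) :
    T.totalOps Q G x ≤ ((κ * n * Nat.log 2 n ^ κ +
      n * wireLoad κ N (Nat.clog 2 p) G.depth : ℕ) : ℕ∞) := by
  rw [totalOps, Finset.sum_add_distrib, Nat.cast_add]
  refine add_le_add hT.quorums_ops ?_
  calc ∑ i, (T.shuffle Q G x i).ops
      ≤ ∑ i, ((shuffleLoad κ p Q G i : ℕ) : ℕ∞) := Finset.sum_le_sum fun i _ =>
        (shuffle_takes hT Q G x i).ops_le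
    _ = ((∑ i, shuffleLoad κ p Q G i : ℕ) : ℕ∞) := by rw [Nat.cast_sum]
    _ ≤ _ := by exact_mod_cast sum_shuffleLoad_le κ p Q G

theorem totalRounds_le (hT : T.WithinCosts κ) (Q : Fin n → (Fin N ↪ Fin n)) (G : Network n)
    (x : Fin n → ZMod p) :
    T.totalRounds Q G x ≤ ((κ + (2 * (κ + 3) + G.depth * (gateRounds κ + 1) + 2) : ℕ) : ℕ∞) := by
  rw [totalRounds, Nat.cast_add]
  refine add_le_add (iSup_le hT.quorums_rounds) (iSup_le fun i => ?_)
  refine (rounds_bind_le (c := 2) (returns_true _) fun st _ => ?_).trans ?_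
  · exact (output_takes Q G i st).choose_spec.rounds_le
  · rw [Nat.cast_add]
    exact add_le_add (shuffle_takes hT Q G x i).rounds_le le_rfl

theorem outputSent_le (p : ℕ) (Q : Fin n → (Fin N ↪ Fin n)) (G : Network n) :
    outputSent p Q G ≤ ((n * (N * (N + n)) : ℕ) : ℕ∞) := by
  rw [← sum_outputLoad Q G, Nat.cast_sum]
  exact Finset.sum_le_sum fun i _ => iSup_le fun st => (output_takes Q G i st).choose_spec.sent_le

/-- Allows the quorum size, bit length and depth to be replaced by their bounds in `log n`, leaving
a function of one variable. -/
theorem wireLoad_mono (κ : ℕ) {N N' b b' d d' : ℕ} (hN : N ≤ N') (hb : b ≤ b') (hd : d ≤ d') :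
    wireLoad κ N b d ≤ wireLoad κ N' b' d' := by
  unfold wireLoad gateCost multiplyCost genRandCost shareCost broadcastRoundCost reconstOps
  gcongr

end Tools

/-! ### Polynomial growth -/

/-- Functions that are bounded by a monomial on the positive integers. -/
def PolyBounded (f : ℕ → ℕ) : Prop := ∃ C k : ℕ, ∀ L, 1 ≤ L → f L ≤ C * L ^ k

namespace PolyBounded
variable {f g : ℕ → ℕ}

theorem const (c : ℕ) : PolyBounded fun _ => c := ⟨c, 0, fun L _ => by simp⟩

theorem id : PolyBounded fun L => L := ⟨1, 1, fun L _ => by simp⟩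

theorem add (hf : PolyBounded f) (hg : PolyBounded g) : PolyBounded fun L => f L + g L := by
  obtain ⟨C, k, hf⟩ := hf
  obtain ⟨D, l, hg⟩ := hg
  refine ⟨C + D, k + l, fun L hL => ?_⟩
  rw [add_mul]
  refine add_le_add ((hf L hL).trans ?_) ((hg L hL).trans ?_) <;>
  exact Nat.mul_le_mul_left _ (Nat.pow_le_pow_right hL (by omega))

theorem mul (hf : PolyBounded f) (hg : PolyBounded g) : PolyBounded fun L => f L * g L := by
  obtain ⟨C, k, hf⟩ := hf
  obtain ⟨D, l, hg⟩ := hg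
  refine ⟨C * D, k + l, fun L hL => (Nat.mul_le_mul (hf L hL) (hg L hL)).trans (le_of_eq ?_)⟩
  ring

theorem pow (hf : PolyBounded f) (m : ℕ) : PolyBounded fun L => f L ^ m := by
  induction m with
  | zero => simpa using const 1
  | succ m ih => simpa only [pow_succ] using ih.mul hf

/-- All exponents in the nested costs are `κ` or numerals, thus fixed, and the closure rules retrace
the definitions. -/
theorem wireLoad (κ : ℕ) {N b d : ℕ → ℕ} (hN : PolyBounded N) (hb : PolyBounded b)
    (hd : PolyBounded d) : PolyBounded fun L => Tools.wireLoad κ (N L) (b L) (d L) := by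
  have hs : PolyBounded fun L => shareCost κ (N L) :=
    ((hN.add (const 1)).mul ((const κ).mul (((hN.add (const 2)).mul
      (((const κ).mul ((hN.add (const 1)).pow κ)).add (const 1))).pow κ))).add
      ((const κ).mul ((hN.add (const 1)).pow κ))
  have hg : PolyBounded fun L => genRandCost κ (N L) :=
    ((hN.mul hs).add hN).add (const 3)
  have hm : PolyBounded fun L => multiplyCost κ (N L) :=
    ((((const 5).mul hg).add ((const 2).mul ((const 100).mul ((hN.add (const 1)).pow 3)))).add
      ((const 2).mul hN)).add (const 9)
  have hG : PolyBounded fun L => gateCost κ (N L) (b L) :=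
    ((((((const κ).mul hb).mul hm).add ((const 2).mul ((const κ).mul (hb.pow κ)))).add
      ((const 8).mul hm)).add ((const 4).mul hg)).add (const 5)
  exact (((hN.add (const 1)).mul hs).add (hN.mul hg)).add (hd.mul (hN.mul (hG.add (const 4))))

end PolyBounded

/-! ### Bit length and choice of constants -/

/-- Since `log n ≥ 1`, one has `n < 2 ^ (log n + 1) ≤ 2 ^ (2 log n)`; this absorbs the rounding of
the logarithm. -/
theorem clog_le_of_le_pow {n p κ : ℕ} (hn : 2 ≤ n) (hp : p ≤ n ^ κ) :
    Nat.clog 2 p ≤ 2 * κ * Nat.log 2 n := by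
  have hL : 0 < Nat.log 2 n := Nat.log_pos one_lt_two hn
  refine Nat.clog_le_of_le_pow (hp.trans ?_)
  calc n ^ κ ≤ (2 ^ (2 * Nat.log 2 n)) ^ κ := by
        refine Nat.pow_le_pow_left ((Nat.lt_pow_succ_log_self one_lt_two n).le.trans ?_) κ
        exact Nat.pow_le_pow_right two_pos (by omega)
    _ = 2 ^ (2 * κ * Nat.log 2 n) := by rw [← pow_mul]; ring_nf

end AnonBroadcast

theorem mainTheorem2 (κ : ℕ) :
    ∃ C k : ℕ, ∀ (n N p : ℕ) [NeZero n] [Fact p.Prime],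
      2 ≤ n → N ≤ κ * Nat.log 2 n → p ≤ n ^ κ →
      ∀ T : AnonBroadcast.Tools n N p, T.WithinCosts κ →
      ∀ G : AnonBroadcast.Network n, G.depth ≤ κ * Nat.log 2 n →
      ∀ (Q : Fin n → (Fin N ↪ Fin n)) (x : Fin n → ZMod p),
        T.totalBits Q G x ≤ ((C * n * Nat.log 2 n ^ k : ℕ) : ℕ∞) ∧
        T.totalOps Q G x ≤ ((C * n * Nat.log 2 n ^ k : ℕ) : ℕ∞) ∧
        T.totalRounds Q G x ≤ ((C * Nat.log 2 n : ℕ) : ℕ∞) ∧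
        AnonBroadcast.Tools.outputSent p Q G ≤ ((C * n ^ 2 * Nat.log 2 n : ℕ) : ℕ∞) := by
  open AnonBroadcast Tools in
  have hlin : ∀ c, PolyBounded fun L => c * L := fun c => (PolyBounded.const c).mul .id
  -- One function serves both counts: the factor `2 * κ * L + 1` dominates the bit length needed for
  -- traffic and the factor `1` needed for operations. The first summand is quorum building.
  obtain ⟨C, k, hC⟩ : PolyBounded fun L => κ * L ^ κ +
      (2 * κ * L + 1) * wireLoad κ (κ * L) (2 * κ * L) (κ * L) :=
    (PolyBounded.mul (.const κ) (.pow .id κ)).add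
      (((hlin _).add (.const 1)).mul (.wireLoad κ (hlin _) (hlin _) (hlin _)))
  -- The three summands serve bits and operations, rounds, and output propagation respectively.
  refine ⟨C + (κ + 2 * (κ + 3) + κ * (gateRounds κ + 1) + 2) + (κ * κ + κ), k, ?_⟩
  intro n N p _ _ hn hN hp T hT G hG Q x
  have hb := clog_le_of_le_pow hn hp
  have hL : 1 ≤ Nat.log 2 n := Nat.log_pos one_lt_two hn
  have hLn : Nat.log 2 n ≤ n := Nat.log_le_self 2 n
  have hw := wireLoad_mono κ hN hb hG
  have hC' := hC _ hL
  dsimp only at hC'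
  generalize hlog : Nat.log 2 n = L at *
  generalize wireLoad κ (κ * L) (2 * κ * L) (κ * L) = W at *
  have hle : n * (κ * L ^ κ + (2 * κ * L + 1) * W) ≤
      (C + (κ + 2 * (κ + 3) + κ * (gateRounds κ + 1) + 2) + (κ * κ + κ)) * n * L ^ k :=
    calc _ ≤ n * (C * L ^ k) := Nat.mul_le_mul_left _ hC'
      _ = C * n * L ^ k := by ring
      _ ≤ _ := Nat.mul_le_mul_right _ (Nat.mul_le_mul_right _ (by omega))
  refine ⟨(totalBits_le hT Q G x).trans (Nat.cast_le.2 (le_trans ?_ hle)),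
    (totalOps_le hT Q G x).trans (Nat.cast_le.2 (le_trans ?_ hle)),
    (totalRounds_le hT Q G x).trans (Nat.cast_le.2 ?_),
    (outputSent_le p Q G).trans (Nat.cast_le.2 ?_)⟩
  · rw [hlog]
    calc _ ≤ κ * n * L ^ κ + (2 * κ * L + 1) * (n * W) := by
          refine add_le_add le_rfl (Nat.mul_le_mul (by omega) (Nat.mul_le_mul_left _ hw))
      _ = _ := by ring
  · rw [hlog]
    calc _ ≤ κ * n * L ^ κ + (2 * κ * L + 1) * (n * W) := by
          refine add_le_add le_rfl ((Nat.mul_le_mul_left _ hw).trans ?_)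
          exact Nat.le_mul_of_pos_left _ (by omega)
      _ = _ := by ring
  -- Since `L ≥ 1`, every constant number of rounds is absorbed into a multiple of `L`.
  · calc _ ≤ κ * L + (2 * (κ + 3) * L + κ * L * (gateRounds κ + 1) + 2 * L) := by
          refine add_le_add (Nat.le_mul_of_pos_right _ hL) (add_le_add (add_le_add
            (Nat.le_mul_of_pos_right _ hL) (Nat.mul_le_mul_right _ hG))
            (Nat.le_mul_of_pos_right _ hL))
      _ = (κ + 2 * (κ + 3) + κ * (gateRounds κ + 1) + 2) * L := by ring
      _ ≤ _ := Nat.mul_le_mul_right _ (by omega)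
  -- In `N * (N + n)` the first factor keeps the bound `κ * L`, while inside the sum the cruder `N ≤
  -- κ * n` suffices.
  · calc _ ≤ n * (κ * L * (κ * n + n)) := by
          gcongr
          exact hN.trans (Nat.mul_le_mul_left _ hLn)
      _ = (κ * κ + κ) * n ^ 2 * L := by ring
      _ ≤ _ := Nat.mul_le_mul_right _ (Nat.mul_le_mul_right _ (by omega))
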